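/- **Definitions.** Let $V$ be a complex vector space with a conjugate-linear involution $*$ (a $*$-vector space); $M_n(V)$ carries the involution $(v_{ij})^*=(v_{ji}^*)$. A *local operator system* is a triple $(V,\{\{\mathcal C_\alpha^n\}_{n\ge1}:\alpha\in\Gamma\},e_V)$, where each $\mathcal C_\alpha^n$ is a (not necessarily proper) cone of hermitian elements of $M_n(V)$, $e_V\in V$ is hermitian, and: * the family is downward filtered: $\Gamma\neq\emptyset$, and for all $\alpha,\beta\in\Gamma$ there is $\gamma\in\Gamma$ with $\mathcal C_\gamma^n\subseteq\mathcal C_\alpha^n\cap\mathcal C_\beta^n$ for all $n$; * $\bigcap_\alpha(\mathcal C_\alpha^n\cap-\mathcal C_\alpha^n)=\{0\}$ for all $n$; * $X^*\mathcal C_\alpha^nX\subseteq\mathcal C_\alpha^m$ for all $X\in M_{n,m}(\mathbb C)$ and all $\alpha$; * $e_V$ is an Archimedean matrix order unit: writing $e_n=\mathrm{diag}(e_V,\dots,e_V)$, for all $\alpha$, $n$ and hermitian $A\in M_n(V)$ there is $r>0$ with $re_n-A\in\mathcal C_\alpha^n$; and if $A\in M_n(V)$ satisfies $re_n+A\in\mathcal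 C_\alpha^n$ for all $r>0$, then $A\in\mathcal C_\alpha^n$. A linear map $\phi:V\to W$ between local operator systems with cones $\mathcal C_\alpha^n$ $(\alpha\in\Gamma)$ and $\mathcal D_\beta^n$ $(\beta\in\Lambda)$ is *local unital completely positive* (local UCP) if $\phi(e_V)=e_W$ and for each $\beta$ there is an $\alpha$ with $\phi^{(n)}(\mathcal C_\alpha^n)\subseteq\mathcal D_\beta^n$ for all $n$. A unital linear map $\phi:V\to M_k=M_k(\mathbb C)$ is local UCP *with respect to* $\mathcal C_\alpha$ if $\phi^{(n)}(\mathcal C_\alpha^n)\subseteq M_{nk}^+$ for all $n$. $\mathcal{LO}$ denotes the category of local operator systems and local UCP maps. A *local unital complete order isomorphism*, relative to an identification $\sigma:\Gamma\cong\Lambda$ of index sets, is a unital linear bijection $\phi$ with $\phi^{(n)}(\mathcal C_\alpha^n)=\mathcal D_{\sigma(\alpha)}^n$ for all $\alpha,n$; "onto its range" means that the range carries the cones $\mathcal D_\beta^n\cap M_n(\phi(V))$. A *local operator system tensor product* $l\tau$ assigns to every pair $(V,W)$ of local operator systems a family of cones $\mathcal T^n_\gamma\subseteq M_n(V\otimes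 W)$, $\gamma\in\Gamma\times\Lambda$, such that 1. $V\otimes_{l\tau}W=(V\otimes W,\{\mathcal T_\gamma^n\},e_V\otimes e_W)$ is a local operator system; 2. for every $(\alpha,\beta)$ there is a $\gamma$, and for every $\gamma$ there is an $(\alpha,\beta)$, with $\mathcal C_\alpha^n\otimes\mathcal D_\beta^m\subseteq\mathcal T_\gamma^{nm}$ for all $n,m$; 3. if $\phi:V\to M_n$ and $\psi:W\to M_m$ are local UCP with respect to $\mathcal C_\alpha$ and $\mathcal D_\beta$, then $\phi\otimes\psi:V\otimes W\to M_{nm}$ is local UCP with respect to $\mathcal T_{(\alpha,\beta)}$. Let $V\otimes_{\mathrm{lmin}}W$ be $V\otimes W$ with the unit $e_V\otimes e_W$ and the cones $$\mathcal T_{(\alpha,\beta)}^{n(\mathrm{lmin})}=\{p=p^*\in M_n(V\otimes W):(\phi\otimes\psi)^{(n)}(p)\in M_{nkm}^+\ \text{for all}\ k,m\ \text{and all local UCP}\ \phi:V\to M_k\ \text{w.r.t.}\ \mathcal C_\alpha,\ \psi:W\to M_m\ \text{w.r.t.}\ \mathcal D_\beta\}.$$ **Statement.** The assignment $(V,W)\mapsto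 V\otimes_{\mathrm{lmin}}W$ is a local operator system tensor product on $\mathcal{LO}$, and it is * *injective*: if $V_1\subseteq V_2$ and $W_1\subseteq W_2$ are local operator subsystems (i.e. the inclusions are local unital complete order isomorphisms onto their ranges), then $V_1\otimes_{\mathrm{lmin}}W_1\to V_2\otimes_{\mathrm{lmin}}W_2$ is a local unital complete order isomorphism onto its range; * *associative*: $(u\otimes v)\otimes w\mapsto u\otimes(v\otimes w)$ is a local unital complete order isomorphism from $(U\otimes_{\mathrm{lmin}}V)\otimes_{\mathrm{lmin}}W$ onto $U\otimes_{\mathrm{lmin}}(V\otimes_{\mathrm{lmin}}W)$; * *symmetric*: $v\otimes w\mapsto w\otimes v$ is a local unital complete order isomorphism from $V\otimes_{\mathrm{lmin}}W$ onto $W\otimes_{\mathrm{lmin}}V$; * *functorial*: if $\phi:V_1\to V_2$ and $\psi:W_1\to W_2$ are local UCP, then so is $\phi\otimes\psi:V_1\otimes_{\mathrm{lmin}}W_1\to V_2\otimes_{\mathrm{lmin}}W_2$. Here the index sets are identified in the canonical way. -/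

import Mathlib

open scoped TensorProduct ComplexOrder

universe u v

noncomputable section

/-- The raw data of a local operator system on a complex vector space `V`: a set
`cone α n = C_α^n ⊆ M_n(V)` for each index `α ∈ Γ` and each `n`, and a distinguished element
`unit = e` of `V`.
(The level `n = 0` is carried along for convenience; `M_0(V)` is a single point, so that it
carries no information.) -/
structure MatrixConeFamily (V : Type*) (Γ : Type*) where
  cone : Γ → (n : ℕ) → Set (Matrix (Fin n) (Fin n) V)
  unit : V

/-- The compression `X^* A X ∈ M_m(V)` of `A ∈ M_n(V)` by a scalar matrix `X ∈ M_{n,m}`. -/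
def compression {V : Type*} [AddCommGroup V] [Module ℂ V] {n m : ℕ}
    (X : Matrix (Fin n) (Fin m) ℂ) (A : Matrix (Fin n) (Fin n) V) :
    Matrix (Fin m) (Fin m) V :=
  Matrix.of fun i j => ∑ k, ∑ l, (star (X k i) * X l j) • A k l

namespace MatrixConeFamily

/-- `e_n = diag(e, …, e) ∈ M_n(V)`. -/
def unitDiag {V Γ : Type*} [AddCommGroup V] (S : MatrixConeFamily V Γ) (n : ℕ) :
    Matrix (Fin n) (Fin n) V :=
  Matrix.diagonal fun _ => S.unit

/-- `(V, {{C_α^n}_n : α ∈ Γ}, e)` is an (abstract) local operator system: each `C_α^n` is a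
(not necessarily proper) cone of hermitian elements of `M_n(V)`, the family is downward filtered,
the intersection of all `C_α^n ∩ -C_α^n` is zero, the cones are compatible under compressions
by scalar matrices, and `e` is an Archimedean matrix order unit. -/
structure IsLocalOperatorSystem {V Γ : Type*} [AddCommGroup V] [Module ℂ V] [StarAddMonoid V]
    [StarModule ℂ V] (S : MatrixConeFamily V Γ) : Prop where
  nonempty : Nonempty Γ
  filtered : ∀ α β : Γ, ∃ γ : Γ, ∀ n, S.cone γ n ⊆ S.cone α n ∩ S.cone β n
  hermitian : ∀ α n, ∀ A ∈ S.cone α n, A.IsHermitian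
  zero_mem : ∀ α n, (0 : Matrix (Fin n) (Fin n) V) ∈ S.cone α n
  add_mem : ∀ α n, ∀ A ∈ S.cone α n, ∀ B ∈ S.cone α n, A + B ∈ S.cone α n
  smul_mem : ∀ α n, ∀ r : ℝ, 0 ≤ r → ∀ A ∈ S.cone α n, (r : ℂ) • A ∈ S.cone α n
  separating : ∀ n, ∀ A : Matrix (Fin n) (Fin n) V,
    (∀ α, A ∈ S.cone α n ∧ -A ∈ S.cone α n) → A = 0
  compression_mem : ∀ α n m, ∀ X : Matrix (Fin n) (Fin m) ℂ, ∀ A ∈ S.cone α n,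
    compression X A ∈ S.cone α m
  unit_hermitian : star S.unit = S.unit
  order_unit : ∀ α n, ∀ A : Matrix (Fin n) (Fin n) V, A.IsHermitian →
    ∃ r : ℝ, 0 < r ∧ (r : ℂ) • S.unitDiag n - A ∈ S.cone α n
  archimedean : ∀ α n, ∀ A : Matrix (Fin n) (Fin n) V,
    (∀ r : ℝ, 0 < r → (r : ℂ) • S.unitDiag n + A ∈ S.cone α n) → A ∈ S.cone α n

/-- `φ : V → W` is local unital completely positive (`φ ∈ LUCP(V, W)`): it is unital, and for each
`β` there is an `α` such that `φ^{(n)}(C_α^n) ⊆ D_β^n` for all `n`. -/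
structure IsLUCP {V Γ W Λ : Type*} [AddCommGroup V] [Module ℂ V] [AddCommGroup W] [Module ℂ W]
    (S : MatrixConeFamily V Γ) (T : MatrixConeFamily W Λ) (φ : V →ₗ[ℂ] W) : Prop where
  map_unit : φ S.unit = T.unit
  map_cone : ∀ β, ∃ α, ∀ n, ∀ A ∈ S.cone α n, A.map φ ∈ T.cone β n

/-- A linear map `φ : V → M_κ` (complex matrices, `κ` a finite index set) is local unital
completely positive with respect to the cones `C_α`: it is unital and `φ^{(n)}(C_α^n)` consists
of positive semidefinite matrices, for all `n`; `M_n(M_κ)` is identified with the complex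
matrices indexed by `Fin n × κ`. -/
structure IsLUCPWrt {V Γ κ : Type*} [Fintype κ] [DecidableEq κ] [AddCommGroup V] [Module ℂ V]
    (S : MatrixConeFamily V Γ) (α : Γ) (φ : V →ₗ[ℂ] Matrix κ κ ℂ) : Prop where
  map_unit : φ S.unit = 1
  map_cone : ∀ n, ∀ A ∈ S.cone α n,
    (Matrix.comp (Fin n) (Fin n) κ κ ℂ (A.map φ)).PosSemidef

/-- `φ : V ≃ W` is a local unital complete order isomorphism, with respect to the identification
`σ : Γ ≃ Λ` of the index sets: it is a unital linear bijection with
`φ^{(n)}(C_α^n) = D_{σ α}^n` for all `α` and `n`. -/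
structure IsCompleteOrderIso {V Γ W Λ : Type*} [AddCommGroup V] [Module ℂ V]
    [AddCommGroup W] [Module ℂ W] (S : MatrixConeFamily V Γ) (T : MatrixConeFamily W Λ)
    (σ : Γ ≃ Λ) (φ : V ≃ₗ[ℂ] W) : Prop where
  map_unit : φ S.unit = T.unit
  map_cone : ∀ α n, (fun A : Matrix (Fin n) (Fin n) V => A.map φ) '' S.cone α n = T.cone (σ α) n

/-- `j : V → W` is a local unital complete order isomorphism onto its range (the range carrying
the cones induced from `W`), with respect to the identification `σ : Γ ≃ Λ` of the index sets.
When `j` is the inclusion of a subspace, this says that `V` is a local operator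
subsystem of `W`. -/
structure IsCompleteOrderEmbedding {V Γ W Λ : Type*} [AddCommGroup V] [Module ℂ V]
    [AddCommGroup W] [Module ℂ W] (S : MatrixConeFamily V Γ) (T : MatrixConeFamily W Λ)
    (σ : Γ ≃ Λ) (j : V →ₗ[ℂ] W) : Prop where
  injective : Function.Injective j
  map_unit : j S.unit = T.unit
  map_cone : ∀ α n, (fun A : Matrix (Fin n) (Fin n) V => A.map j) '' S.cone α n =
    {B | B ∈ T.cone (σ α) n ∧ ∀ i k, B i k ∈ LinearMap.range j}

/-- For `φ : V → M_κ` and `ψ : W → M_μ`, the map `φ ⊗ ψ : V ⊗ W → M_κ ⊗ M_μ = M_{κ × μ}`,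
`v ⊗ w ↦ φ(v) ⊗ ψ(w)` (Kronecker product). -/
def tensorMap {V W κ μ : Type*} [AddCommGroup V] [Module ℂ V] [AddCommGroup W] [Module ℂ W]
    (φ : V →ₗ[ℂ] Matrix κ κ ℂ) (ψ : W →ₗ[ℂ] Matrix μ μ ℂ) :
    V ⊗[ℂ] W →ₗ[ℂ] Matrix (κ × μ) (κ × μ) ℂ :=
  TensorProduct.lift
    ((Matrix.kroneckerMapBilinear (LinearMap.mul ℂ ℂ) :
      Matrix κ κ ℂ →ₗ[ℂ] Matrix μ μ ℂ →ₗ[ℂ] Matrix (κ × μ) (κ × μ) ℂ).compl₁₂ φ ψ)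

/-- For `P ∈ M_n(V)` and `Q ∈ M_m(W)`, the element `P ⊗ Q` of `M_{nm}(V ⊗ W)`. -/
def kron {V W : Type*} [AddCommGroup V] [Module ℂ V] [AddCommGroup W] [Module ℂ W] {n m : ℕ}
    (P : Matrix (Fin n) (Fin n) V) (Q : Matrix (Fin m) (Fin m) W) :
    Matrix (Fin (n * m)) (Fin (n * m)) (V ⊗[ℂ] W) :=
  Matrix.reindex finProdFinEquiv finProdFinEquiv
    (Matrix.kroneckerMap (fun v w => v ⊗ₜ[ℂ] w) P Q)

/-- `R = {T_{(α,β)}^n}` is a local operator system structure on `V ⊗ W` for the local operator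
systems `V` and `W`, the index set being `Γ × Λ`. -/
structure IsTensorStructure {V Γ W Λ : Type*}
    [AddCommGroup V] [Module ℂ V] [StarAddMonoid V] [StarModule ℂ V]
    [AddCommGroup W] [Module ℂ W] [StarAddMonoid W] [StarModule ℂ W]
    (S : MatrixConeFamily V Γ) (T : MatrixConeFamily W Λ)
    (R : MatrixConeFamily (V ⊗[ℂ] W) (Γ × Λ)) : Prop where
  unit_eq : R.unit = S.unit ⊗ₜ[ℂ] T.unit
  isLocalOperatorSystem : R.IsLocalOperatorSystem
  exists_index : ∀ (α : Γ) (β : Λ), ∃ γ : Γ × Λ, ∀ n m,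
    ∀ P ∈ S.cone α n, ∀ Q ∈ T.cone β m, kron P Q ∈ R.cone γ (n * m)
  exists_pair : ∀ γ : Γ × Λ, ∃ (α : Γ) (β : Λ), ∀ n m,
    ∀ P ∈ S.cone α n, ∀ Q ∈ T.cone β m, kron P Q ∈ R.cone γ (n * m)
  tensorMap_lucp : ∀ (α : Γ) (β : Λ) (n m : ℕ)
    (φ : V →ₗ[ℂ] Matrix (Fin n) (Fin n) ℂ) (ψ : W →ₗ[ℂ] Matrix (Fin m) (Fin m) ℂ),
    S.IsLUCPWrt α φ → T.IsLUCPWrt β ψ → R.IsLUCPWrt (α, β) (tensorMap φ ψ)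

/-- The cones of the minimal local tensor product: `T_{(α,β)}^n` consists of the hermitian
`p ∈ M_n(V ⊗ W)` such that `(φ ⊗ ψ)^{(n)}(p)` is positive semidefinite for all local unital
completely positive `φ : V → M_k` with respect to `C_α` and `ψ : W → M_m` with respect
to `D_β`. -/
def lmin {V Γ W Λ : Type*}
    [AddCommGroup V] [Module ℂ V] [StarAddMonoid V] [StarModule ℂ V]
    [AddCommGroup W] [Module ℂ W] [StarAddMonoid W] [StarModule ℂ W]
    (S : MatrixConeFamily V Γ) (T : MatrixConeFamily W Λ) :
    MatrixConeFamily (V ⊗[ℂ] W) (Γ × Λ) where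
  cone γ n := {p | p.IsHermitian ∧ ∀ (k m : ℕ)
    (φ : V →ₗ[ℂ] Matrix (Fin k) (Fin k) ℂ) (ψ : W →ₗ[ℂ] Matrix (Fin m) (Fin m) ℂ),
    S.IsLUCPWrt γ.1 φ → T.IsLUCPWrt γ.2 ψ →
      (Matrix.comp (Fin n) (Fin n) (Fin k × Fin m) (Fin k × Fin m) ℂ
        (p.map (tensorMap φ ψ))).PosSemidef}
  unit := S.unit ⊗ₜ[ℂ] T.unit

end MatrixConeFamily

/-- The objects of the category `LO`: local operator systems. Its morphisms `V → W` are the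
linear maps satisfying `V.cones.IsLUCP W.cones`. -/
structure LO where
  carrier : Type u
  index : Type v
  [addCommGroup : AddCommGroup carrier]
  [module : Module ℂ carrier]
  [starAddMonoid : StarAddMonoid carrier]
  [starModule : StarModule ℂ carrier]
  cones : MatrixConeFamily carrier index
  isLocalOperatorSystem : cones.IsLocalOperatorSystem

attribute [instance] LO.addCommGroup LO.module LO.starAddMonoid LO.starModule

/-- A local operator system tensor product: an assignment of a local operator system structure on
`V ⊗ W` to every pair `(V, W)` of local operator systems. -/
structure LocalTensorProduct where
  cones : ∀ V W : LO.{u, v}, MatrixConeFamily (V.carrier ⊗[ℂ] W.carrier) (V.index × W.index)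
  isTensorStructure : ∀ V W : LO.{u, v}, V.cones.IsTensorStructure W.cones (cones V W)

namespace LocalTensorProduct

/-- The local operator system `V ⊗_τ W`. -/
@[reducible] def obj (τ : LocalTensorProduct.{u, v}) (V W : LO.{u, v}) : LO.{u, v} where
  carrier := V.carrier ⊗[ℂ] W.carrier
  index := V.index × W.index
  cones := τ.cones V W
  isLocalOperatorSystem := (τ.isTensorStructure V W).isLocalOperatorSystem

/-- `φ ⊗ ψ ∈ LUCP(V₁ ⊗_τ W₁, V₂ ⊗_τ W₂)` for `φ ∈ LUCP(V₁, V₂)` and `ψ ∈ LUCP(W₁, W₂)`. -/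
def IsFunctorial (τ : LocalTensorProduct.{u, v}) : Prop :=
  ∀ (V₁ V₂ W₁ W₂ : LO.{u, v}) (φ : V₁.carrier →ₗ[ℂ] V₂.carrier) (ψ : W₁.carrier →ₗ[ℂ] W₂.carrier),
    V₁.cones.IsLUCP V₂.cones φ → W₁.cones.IsLUCP W₂.cones ψ →
      (τ.obj V₁ W₁).cones.IsLUCP (τ.obj V₂ W₂).cones (TensorProduct.map φ ψ)

/-- `v ⊗ w ↦ w ⊗ v` is a local unital complete order isomorphism from `V ⊗_τ W` onto
`W ⊗_τ V`. -/
def IsSymmetric (τ : LocalTensorProduct.{u, v}) : Prop :=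
  ∀ V W : LO.{u, v},
    (τ.obj V W).cones.IsCompleteOrderIso (τ.obj W V).cones (Equiv.prodComm V.index W.index)
      (TensorProduct.comm ℂ V.carrier W.carrier)

/-- `(u ⊗ v) ⊗ w ↦ u ⊗ (v ⊗ w)` is a local unital complete order isomorphism from
`(U ⊗_τ V) ⊗_τ W` onto `U ⊗_τ (V ⊗_τ W)`. -/
def IsAssociative (τ : LocalTensorProduct.{u, v}) : Prop :=
  ∀ U V W : LO.{u, v},
    (τ.obj (τ.obj U V) W).cones.IsCompleteOrderIso (τ.obj U (τ.obj V W)).cones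
      (Equiv.prodAssoc U.index V.index W.index)
      (TensorProduct.assoc ℂ U.carrier V.carrier W.carrier)

/-- If `V₁ ⊆ V₂` and `W₁ ⊆ W₂` are local operator subsystems, then `V₁ ⊗_τ W₁ → V₂ ⊗_τ W₂` is a
local unital complete order isomorphism onto its range. -/
def IsInjective (τ : LocalTensorProduct.{u, v}) : Prop :=
  ∀ (V₁ V₂ W₁ W₂ : LO.{u, v}) (σ : V₁.index ≃ V₂.index) (ρ : W₁.index ≃ W₂.index)
    (i : V₁.carrier →ₗ[ℂ] V₂.carrier) (j : W₁.carrier →ₗ[ℂ] W₂.carrier),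
    V₁.cones.IsCompleteOrderEmbedding V₂.cones σ i →
    W₁.cones.IsCompleteOrderEmbedding W₂.cones ρ j →
      (τ.obj V₁ W₁).cones.IsCompleteOrderEmbedding (τ.obj V₂ W₂).cones (Equiv.prodCongr σ ρ)
        (TensorProduct.map i j)

end LocalTensorProduct

end

/-! Everything rests on the correspondence between linear maps `φ : V → M_k` and functionals `G` on
`M_k(V)`, given by `G(A) = ∑ φ(A i j) i j`. The quadratic form of `φ^{(n)}(A)` at a vector is `G` of
a scalar compression of `A`, so compatibility of the cones with compressions turns positivity of `G`
on the single cone `C_α^k` into complete positivity of `φ`. Krein's extension of positive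
functionals past an order unit then yields Arveson extension for matrix-valued maps
(`IsLUCPWrt.exists_extension`) and, applied to an enlarged cone, states separating points
(`IsLocalOperatorSystem.eq_zero_of_forall_state`).

The lmin cones are defined by testing against maps `φ ⊗ ψ`, so closure under sums, compressions and
Archimedean limits passes over from positive semidefinite matrices. Two axioms need work. Separation
follows from slicing: product states separate points because states do so on each factor. The order
unit needs a bound on `φ ⊗ ψ` uniform in `φ` and `ψ`; it holds for tensors of positive elements, and
these span (`mem_boundedElements`).

Functoriality is composition of test maps. Injectivity is the statement that all test maps on the
small systems extend to the large ones. For associativity, a test map `θ` on `V ⊗ W` need not be a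
product, so `φ ⊗ θ` is applied in two stages: slicing by `φ` gives a larger matrix over `V ⊗ W`,
which lies in its lmin cone because products `(φ ⊗ ψ) ⊗ χ` are positive on the original element, and
`θ` is positive on that cone. -/

noncomputable section

open Matrix

/-! ### Extension of positive functionals -/

/-- **Krein extension**: a complex linear functional on a subspace containing an order unit, which
is positive there, extends to a positive functional. -/
theorem exists_positive_extension {M : Type*} [AddCommGroup M] [Module ℂ M] [StarAddMonoid M]
    [StarModule ℂ M] (C : Set M) (zero_mem : (0 : M) ∈ C)
    (add_mem : ∀ a ∈ C, ∀ b ∈ C, a + b ∈ C)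
    (smul_mem : ∀ r : ℝ, 0 ≤ r → ∀ a ∈ C, (r : ℂ) • a ∈ C)
    (selfAdjoint : ∀ a ∈ C, IsSelfAdjoint a) (e : M) (he : IsSelfAdjoint e)
    (order_unit : ∀ a, IsSelfAdjoint a → ∃ r : ℝ, (r : ℂ) • e - a ∈ C)
    (N : Submodule ℂ M) (heN : e ∈ N) (F : N →ₗ[ℂ] ℂ)
    (hF : ∀ x : N, (x : M) + star (x : M) ∈ C → 0 ≤ (F x).re) :
    ∃ G : M →ₗ[ℂ] ℂ, (∀ x : N, G x = F x) ∧ ∀ a ∈ C, 0 ≤ G a := by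
  -- `C` contains only selfadjoint elements, so the real extension theorem is applied to the cone of
  -- all elements whose real part lies in `C`. It contains every skew-adjoint element together with
  -- its negative.
  let s : PointedCone ℝ M :=
    { carrier := {x | x + star x ∈ C}
      add_mem' := fun {a b} ha hb => by
        have h := add_mem _ ha _ hb
        simp only [Set.mem_ofPred_eq, star_add]
        rwa [add_add_add_comm]
      zero_mem' := by simpa using zero_mem
      smul_mem' := fun r a ha => by
        have h := smul_mem r r.2 _ ha
        have h' : r • a = ((r : ℝ) : ℂ) • a := (Complex.coe_smul (r : ℝ) a).symm
        simp only [Set.mem_ofPred_eq, h', star_smul]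
        simpa [smul_add] using h }
  have hs : ∀ x, x ∈ s ↔ x + star x ∈ C := fun x => Iff.rfl
  let f : M →ₗ.[ℝ] ℝ := ⟨N.restrictScalars ℝ, Complex.reLm ∘ₗ F.restrictScalars ℝ⟩
  obtain ⟨g, hgf, hgs⟩ := riesz_extension s f (fun x hx => hF ⟨x, x.2⟩ hx) (fun y => by
    obtain ⟨r, hr⟩ := order_unit (-(y + star y)) (by
      simp [IsSelfAdjoint, add_comm])
    refine ⟨⟨((r / 2 : ℝ) : ℂ) • e, N.smul_mem _ heN⟩, ?_⟩
    rw [hs]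
    convert hr using 1
    simp only [star_add, star_smul, he.star_eq]
    simp only [Complex.star_def, Complex.conj_ofReal]
    rw [add_add_add_comm, ← add_smul, sub_neg_eq_add]
    congr 2
    push_cast
    ring)
  -- The complex functional with real part `g`. On selfadjoint `a` the element `i a` is skew, so `g`
  -- kills it and the value at `a` is real.
  have hG : ∀ x, (Module.Dual.extendRCLike (𝕜 := ℂ) g : M →ₗ[ℂ] ℂ) x =
      (g x : ℂ) - Complex.I * g (Complex.I • x) := fun x => rfl
  refine ⟨Module.Dual.extendRCLike (𝕜 := ℂ) g, fun x => ?_, fun a ha => ?_⟩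
  · have h1 : g x = (F x).re := hgf ⟨x, x.2⟩
    have h2 : g (Complex.I • (x : M)) = (F (Complex.I • x)).re :=
      hgf ⟨Complex.I • (x : M), N.smul_mem _ x.2⟩
    rw [hG, h1, h2]
    apply Complex.ext <;> simp
  · have hskew : ∀ b, b + star b = 0 → g b = 0 := by
      intro b hb
      have h1 := hgs b ((hs b).2 (hb ▸ zero_mem))
      have h2 := hgs (-b) ((hs (-b)).2 (by
        rw [star_neg, ← neg_add, hb, neg_zero]; exact zero_mem))
      rw [map_neg] at h2
      linarith
    have h1 : g (Complex.I • a) = 0 := hskew _ (by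
      simp [star_smul, (selfAdjoint a ha).star_eq])
    have h2 : 0 ≤ g a := hgs a ((hs a).2 (by
      rw [(selfAdjoint a ha).star_eq]; exact add_mem _ ha _ ha))
    rw [hG, h1]
    simpa using h2

/-- A complex linear map preserving selfadjointness preserves the involution. -/
theorem LinearMap.map_star_of_isSelfAdjoint {V W : Type*} [AddCommGroup V] [Module ℂ V]
    [StarAddMonoid V] [StarModule ℂ V] [AddCommGroup W] [Module ℂ W]
    [StarAddMonoid W] [StarModule ℂ W] (f : V →ₗ[ℂ] W)
    (h : ∀ v, IsSelfAdjoint v → IsSelfAdjoint (f v)) (v : V) : f (star v) = star (f v) := by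
  have h1 := h _ (realPart v).2
  have h2 := h _ (imaginaryPart v).2
  have hv := realPart_add_I_smul_imaginaryPart v
  rw [← hv]
  simp only [star_add, star_smul, map_add, map_smul, h1.star_eq, h2.star_eq]
  rw [(realPart v).2.star_eq, (imaginaryPart v).2.star_eq]

namespace MatrixConeFamily

/-! ### Matrix-valued maps and functionals on matrices -/

section Functional

variable {V Γ : Type*} [AddCommGroup V] [Module ℂ V]

/-- The linear map `V → M_k` attached to a functional on `M_k(V)`. -/
def mapOfFunctional {k : ℕ} (G : Matrix (Fin k) (Fin k) V →ₗ[ℂ] ℂ) :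
    V →ₗ[ℂ] Matrix (Fin k) (Fin k) ℂ where
  toFun v := Matrix.of fun i j => G (Matrix.single i j v)
  map_add' v w := by ext i j; simp [Matrix.single_add]
  map_smul' c v := by ext i j; simp [← Matrix.smul_single]

@[simp]
theorem mapOfFunctional_apply {k : ℕ} (G : Matrix (Fin k) (Fin k) V →ₗ[ℂ] ℂ) (v : V)
    (i j : Fin k) : mapOfFunctional G v i j = G (Matrix.single i j v) := rfl

/-- The functional on `M_k(V)` attached to a linear map `V → M_k`. -/
def functionalOfMap {k : ℕ} (φ : V →ₗ[ℂ] Matrix (Fin k) (Fin k) ℂ) :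
    Matrix (Fin k) (Fin k) V →ₗ[ℂ] ℂ where
  toFun A := ∑ i, ∑ j, φ (A i j) i j
  map_add' A B := by simp [Finset.sum_add_distrib]
  map_smul' c A := by simp [Finset.mul_sum]

theorem functionalOfMap_apply {k : ℕ} (φ : V →ₗ[ℂ] Matrix (Fin k) (Fin k) ℂ)
    (A : Matrix (Fin k) (Fin k) V) : functionalOfMap φ A = ∑ i, ∑ j, φ (A i j) i j := rfl

theorem functionalOfMap_single {k : ℕ} (φ : V →ₗ[ℂ] Matrix (Fin k) (Fin k) ℂ) (i j : Fin k)
    (v : V) : functionalOfMap φ (Matrix.single i j v) = φ v i j := by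
  rw [functionalOfMap_apply, Finset.sum_eq_single i, Finset.sum_eq_single j]
  · simp
  · intro b _ hb
    simp [Matrix.single, hb.symm]
  · simp
  · intro b _ hb
    refine Finset.sum_eq_zero fun c _ => ?_
    simp [Matrix.single, hb.symm]
  · simp

theorem apply_eq_sum_single {k : ℕ} (G : Matrix (Fin k) (Fin k) V →ₗ[ℂ] ℂ)
    (A : Matrix (Fin k) (Fin k) V) : G A = ∑ i, ∑ j, G (Matrix.single i j (A i j)) := by
  conv_lhs => rw [Matrix.matrix_eq_sum_single A]
  simp

theorem star_dotProduct_comp_mulVec {κ : Type*} [Fintype κ] {n : ℕ}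
    (M : Matrix (Fin n) (Fin n) (Matrix κ κ ℂ)) (x : Fin n × κ → ℂ) :
    star x ⬝ᵥ (Matrix.comp (Fin n) (Fin n) κ κ ℂ M *ᵥ x) =
      ∑ i, ∑ j, ∑ p, ∑ q, star (x (p, i)) * x (q, j) * M p q i j := by
  simp only [dotProduct, mulVec, Fintype.sum_prod_type, Finset.mul_sum, Matrix.comp_apply,
    Pi.star_apply]
  rw [Finset.sum_comm]
  refine Finset.sum_congr rfl fun i _ => ?_
  refine Eq.trans (Finset.sum_congr rfl fun p _ => Finset.sum_comm) ?_
  rw [Finset.sum_comm]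
  refine Finset.sum_congr rfl fun j _ => Finset.sum_congr rfl fun p _ =>
    Finset.sum_congr rfl fun q _ => by ring

/-- A vector of `ℂ^n ⊗ ℂ^k` is read as an `n × k` matrix and used as the compressing matrix. This
reduces positivity at every level `n` to positivity of `G` at level `k`. -/
theorem functional_compression {k n : ℕ} (G : Matrix (Fin k) (Fin k) V →ₗ[ℂ] ℂ)
    (A : Matrix (Fin n) (Fin n) V) (x : Fin n × Fin k → ℂ) :
    G (compression (Matrix.of fun p i => x (p, i)) A) =
      star x ⬝ᵥ (Matrix.comp (Fin n) (Fin n) (Fin k) (Fin k) ℂ (A.map (mapOfFunctional G)) *ᵥ x) := by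
  rw [star_dotProduct_comp_mulVec, apply_eq_sum_single]
  refine Finset.sum_congr rfl fun i _ => Finset.sum_congr rfl fun j _ => ?_
  have h : ∀ v, G (Matrix.single i j v) = (G ∘ₗ Matrix.singleLinearMap ℂ i j) v := fun _ => rfl
  simp only [compression, Matrix.of_apply, Matrix.map_apply, mapOfFunctional_apply, h, map_sum,
    map_smul, smul_eq_mul]

/-- The functional is the quadratic form of `φ^{(k)}(A)` at the maximally entangled vector `∑ e_i ⊗
e_i`. -/
theorem IsLUCPWrt.functionalOfMap_nonneg {S : MatrixConeFamily V Γ} {k : ℕ} {α : Γ} {φ : V →ₗ[ℂ] Matrix (Fin k) (Fin k) ℂ}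
    (hφ : S.IsLUCPWrt α φ) {A : Matrix (Fin k) (Fin k) V} (hA : A ∈ S.cone α k) :
    0 ≤ functionalOfMap φ A := by
  have h := (hφ.map_cone k A hA).dotProduct_mulVec_nonneg (fun x => if x.1 = x.2 then 1 else 0)
  rw [star_dotProduct_comp_mulVec] at h
  simpa [functionalOfMap_apply] using h

end Functional

/-! ### Compatibility with the involution; positive functionals give local UCP maps -/

section LUCP

variable {V Γ : Type*} [AddCommGroup V] [Module ℂ V] [StarAddMonoid V] [StarModule ℂ V]
  {S : MatrixConeFamily V Γ}

theorem IsLocalOperatorSystem.unitDiag_mem (hS : S.IsLocalOperatorSystem) (α : Γ) (n : ℕ) :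
    S.unitDiag n ∈ S.cone α n := by
  obtain ⟨r, hr, h⟩ := hS.order_unit α n 0 (Matrix.isHermitian_zero)
  have := hS.smul_mem α n r⁻¹ (inv_nonneg.2 hr.le) _ h
  rwa [sub_zero, smul_smul, ← Complex.ofReal_mul, inv_mul_cancel₀ hr.ne', Complex.ofReal_one,
    one_smul] at this

theorem IsLocalOperatorSystem.isHermitian_unitDiag (hS : S.IsLocalOperatorSystem) (n : ℕ) :
    (S.unitDiag n).IsHermitian :=
  Matrix.isHermitian_diagonal_of_self_adjoint _ (funext fun _ => hS.unit_hermitian)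

theorem comp_map_isHermitian {V κ : Type*} [AddCommGroup V] [Module ℂ V] [StarAddMonoid V] (φ : V →ₗ[ℂ] Matrix κ κ ℂ)
    (hφ : ∀ v, φ (star v) = star (φ v)) {n : ℕ} {A : Matrix (Fin n) (Fin n) V}
    (hA : A.IsHermitian) :
    (Matrix.comp (Fin n) (Fin n) κ κ ℂ (A.map φ)).IsHermitian := by
  ext ⟨p, i⟩ ⟨q, j⟩
  have h := hφ (A q p)
  rw [hA.apply p q] at h
  simp [h, Matrix.star_apply]

/-- A linear map with selfadjoint values on one of the cones preserves the involution. -/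
theorem IsLocalOperatorSystem.map_star_of_cone (hS : S.IsLocalOperatorSystem) {W : Type*}
    [AddCommGroup W] [Module ℂ W] [StarAddMonoid W] [StarModule ℂ W] (α : Γ) (f : V →ₗ[ℂ] W)
    (hf : ∀ A ∈ S.cone α 1, IsSelfAdjoint (f (A 0 0))) (v : V) : f (star v) = star (f v) := by
  refine f.map_star_of_isSelfAdjoint (fun v hv => ?_) v
  obtain ⟨r, -, hr⟩ := hS.order_unit α 1 (Matrix.of fun _ _ => v) (by ext i j; exact hv)
  have h1 := hf _ hr
  have h2 := hf _ (hS.unitDiag_mem α 1)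
  simp only [unitDiag, Matrix.sub_apply, Matrix.smul_apply, Matrix.diagonal_apply_eq,
    Matrix.of_apply] at h1 h2
  -- The order unit writes a selfadjoint element as a difference of two elements of the cone.
  have h3 : f v = (r : ℂ) • f S.unit - f ((r : ℂ) • S.unit - v) := by
    rw [map_sub, map_smul, sub_sub_cancel]
  rw [h3]
  exact IsSelfAdjoint.sub (IsSelfAdjoint.smul (Complex.conj_ofReal r) h2) h1

theorem IsLUCPWrt.map_star {κ : Type*} [Fintype κ] [DecidableEq κ]
    (hS : S.IsLocalOperatorSystem) {α : Γ} {φ : V →ₗ[ℂ] Matrix κ κ ℂ} (hφ : S.IsLUCPWrt α φ)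
    (v : V) : φ (star v) = star (φ v) := by
  refine hS.map_star_of_cone α φ (fun A hA => ?_) v
  ext i j
  exact (hφ.map_cone 1 A hA).isHermitian.apply (0, i) (0, j)

theorem IsLocalOperatorSystem.functional_map_star (hS : S.IsLocalOperatorSystem) {α : Γ} {k : ℕ}
    {G : Matrix (Fin k) (Fin k) V →ₗ[ℂ] ℂ} (hG : ∀ A ∈ S.cone α k, 0 ≤ G A)
    (A : Matrix (Fin k) (Fin k) V) : G (star A) = star (G A) := by
  refine G.map_star_of_isSelfAdjoint (fun A hA => ?_) A
  obtain ⟨r, -, hr⟩ := hS.order_unit α k A hA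
  have h1 := IsSelfAdjoint.of_nonneg (hG _ hr)
  have h2 := IsSelfAdjoint.of_nonneg (hG _ (hS.unitDiag_mem α k))
  have h3 : G A = (r : ℂ) • G (S.unitDiag k) - G ((r : ℂ) • S.unitDiag k - A) := by
    rw [map_sub, map_smul, sub_sub_cancel]
  rw [h3]
  exact IsSelfAdjoint.sub (IsSelfAdjoint.smul (Complex.conj_ofReal r) h2) h1

theorem IsLocalOperatorSystem.isLUCPWrt_mapOfFunctional (hS : S.IsLocalOperatorSystem) {α : Γ}
    {k : ℕ} {G : Matrix (Fin k) (Fin k) V →ₗ[ℂ] ℂ} (hG : ∀ A ∈ S.cone α k, 0 ≤ G A)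
    (h1 : mapOfFunctional G S.unit = 1) : S.IsLUCPWrt α (mapOfFunctional G) where
  map_unit := h1
  map_cone n A hA := by
    refine Matrix.PosSemidef.of_dotProduct_mulVec_nonneg
      (comp_map_isHermitian _ (fun v => ?_) (hS.hermitian α n A hA)) fun x => ?_
    · ext i j
      simp only [mapOfFunctional_apply, Matrix.star_apply, ← hS.functional_map_star hG]
      rw [Matrix.star_eq_conjTranspose, Matrix.conjTranspose_single]
    · rw [← functional_compression]
      exact hG _ (hS.compression_mem α n k _ A hA)

end LUCP

end MatrixConeFamily

namespace MatrixConeFamily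

/-! ### Arveson extension and separation by states -/

section Extension

variable {V Γ W Λ : Type*} [AddCommGroup V] [Module ℂ V] [StarAddMonoid V] [StarModule ℂ V]
  [AddCommGroup W] [Module ℂ W] [StarAddMonoid W] [StarModule ℂ W]
  {S : MatrixConeFamily V Γ} {T : MatrixConeFamily W Λ}

theorem IsCompleteOrderEmbedding.map_mem_iff {V Γ W Λ : Type*} [AddCommGroup V] [Module ℂ V]
    [AddCommGroup W] [Module ℂ W] {S : MatrixConeFamily V Γ} {T : MatrixConeFamily W Λ}
    {σ : Γ ≃ Λ} {j : V →ₗ[ℂ] W} (hj : S.IsCompleteOrderEmbedding T σ j) {α : Γ} {n : ℕ}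
    {A : Matrix (Fin n) (Fin n) V} : A.map j ∈ T.cone (σ α) n ↔ A ∈ S.cone α n := by
  constructor
  · intro h
    obtain ⟨B, hB, hBA⟩ := (hj.map_cone α n).ge ⟨h, fun i k => ⟨A i k, rfl⟩⟩
    rwa [← Matrix.map_injective hj.injective hBA]
  · intro h
    exact ((hj.map_cone α n).le ⟨A, h, rfl⟩).1

theorem IsCompleteOrderEmbedding.map_star (hS : S.IsLocalOperatorSystem)
    (hT : T.IsLocalOperatorSystem) {σ : Γ ≃ Λ} {j : V →ₗ[ℂ] W}
    (hj : S.IsCompleteOrderEmbedding T σ j) (v : V) : j (star v) = star (j v) := by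
  obtain ⟨α⟩ := hS.nonempty
  exact hS.map_star_of_cone α j
    (fun A hA => (hT.hermitian _ _ _ (hj.map_mem_iff.2 hA)).apply 0 0) v

theorem IsLUCP.map_star (hS : S.IsLocalOperatorSystem) (hT : T.IsLocalOperatorSystem)
    {f : V →ₗ[ℂ] W} (hf : S.IsLUCP T f) (v : V) : f (star v) = star (f v) := by
  obtain ⟨β⟩ := hT.nonempty
  obtain ⟨α, hα⟩ := hf.map_cone β
  exact hS.map_star_of_cone α f (fun A hA => (hT.hermitian _ _ _ (hα 1 A hA)).apply 0 0) v

/-- **Arveson's extension theorem** for maps into matrix algebras. -/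
theorem IsLUCPWrt.exists_extension (hS : S.IsLocalOperatorSystem)
    (hT : T.IsLocalOperatorSystem) {σ : Γ ≃ Λ} {j : V →ₗ[ℂ] W}
    (hj : S.IsCompleteOrderEmbedding T σ j) {α : Γ} {k : ℕ}
    {φ : V →ₗ[ℂ] Matrix (Fin k) (Fin k) ℂ} (hφ : S.IsLUCPWrt α φ) :
    ∃ φ' : W →ₗ[ℂ] Matrix (Fin k) (Fin k) ℂ, T.IsLUCPWrt (σ α) φ' ∧ φ' ∘ₗ j = φ := by
  let J : Matrix (Fin k) (Fin k) V →ₗ[ℂ] Matrix (Fin k) (Fin k) W := j.mapMatrix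
  have hJ : Function.Injective J := Matrix.map_injective hj.injective
  let E := LinearEquiv.ofInjective J hJ
  have hE : ∀ A, E.symm ⟨J A, A, rfl⟩ = A := fun A => by
    rw [LinearEquiv.symm_apply_eq]; rfl
  have hpos : ∀ A ∈ S.cone α k, 0 ≤ functionalOfMap φ A := fun A hA =>
    hφ.functionalOfMap_nonneg hA
  -- The functional of `φ` is transported to the subspace `j(M_k(V))` of `M_k(W)`, where it is
  -- positive because `j` reflects the cones. The map of its extension is the required one.
  obtain ⟨G, hGF, hG⟩ := exists_positive_extension (T.cone (σ α) k) (hT.zero_mem _ _)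
    (hT.add_mem _ _) (hT.smul_mem _ _) (hT.hermitian _ _) (T.unitDiag k)
    (hT.isHermitian_unitDiag k)
    (fun A hA => (hT.order_unit (σ α) k A hA).imp fun r h => h.2) (LinearMap.range J)
    ⟨S.unitDiag k, by
      simp [J, unitDiag, Matrix.diagonal_map, hj.map_unit, LinearMap.mapMatrix_apply]⟩
    (functionalOfMap φ ∘ₗ E.symm.toLinearMap) (by
      rintro ⟨_, A, rfl⟩ h
      have h1 : J A + star (J A) = (A + star A).map j := by
        ext p q
        simp [J, Matrix.star_apply, hj.map_star hS hT]
      simp only [h1, hj.map_mem_iff] at h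
      have h2 := hpos _ h
      rw [map_add, hS.functional_map_star hpos] at h2
      simp only [LinearMap.comp_apply, LinearEquiv.coe_coe, hE]
      have h3 := (Complex.le_def.1 h2).1
      simp at h3
      linarith)
  have hGJ : ∀ A, G (J A) = functionalOfMap φ A := fun A => by
    rw [hGF ⟨J A, A, rfl⟩, LinearMap.comp_apply, LinearEquiv.coe_coe, hE]
  have hcomp : mapOfFunctional G ∘ₗ j = φ := by
    ext v p q
    have h : Matrix.single p q (j v) = J (Matrix.single p q v) := by
      simp [J, LinearMap.mapMatrix_apply, Matrix.map_single]
    rw [LinearMap.comp_apply, mapOfFunctional_apply, h, hGJ, functionalOfMap_single]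
  refine ⟨mapOfFunctional G, hT.isLUCPWrt_mapOfFunctional hG ?_, hcomp⟩
  rw [← hj.map_unit, ← LinearMap.comp_apply, hcomp, hφ.map_unit]

/-- Selfadjoint elements outside a cone are separated from it by a state. -/
theorem IsLocalOperatorSystem.exists_state_ne_zero (hS : S.IsLocalOperatorSystem) {α : Γ}
    {A : Matrix (Fin 1) (Fin 1) V} (hA : A.IsHermitian) (hA' : A ∉ S.cone α 1) :
    ∃ φ : V →ₗ[ℂ] Matrix (Fin 1) (Fin 1) ℂ, S.IsLUCPWrt α φ ∧ φ (A 0 0) ≠ 0 := by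
  set e := S.unitDiag 1 with he
  set C := S.cone α 1 with hC
  -- The Archimedean property leaves room: `w = r₀ e + A` is still outside `C`, so a state with `G w
  -- ≤ 0` has `G A ≤ -r₀ < 0`.
  obtain ⟨r₀, hr₀, hw⟩ : ∃ r : ℝ, 0 < r ∧ (r : ℂ) • e + A ∉ C := by
    by_contra! h
    exact hA' (hS.archimedean α 1 A h)
  set w := (r₀ : ℂ) • e + A with hwdef
  have heC : e ∈ C := hS.unitDiag_mem α 1
  have hesa : IsSelfAdjoint e := hS.isHermitian_unitDiag 1
  obtain ⟨R, -, hR⟩ := hS.order_unit α 1 (-A) hA.neg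
  rw [sub_neg_eq_add] at hR
  -- Otherwise `C` contains all real multiples of `e`, hence also `w = (R e + A) + (r₀ - R) e`.
  have hne : ∀ s : ℝ, s < 0 → (s : ℂ) • e ∉ C := by
    intro s hs h
    have hall : ∀ t : ℝ, (t : ℂ) • e ∈ C := by
      intro t
      rcases le_total 0 t with ht | ht
      · exact hS.smul_mem α 1 t ht e heC
      · have := hS.smul_mem α 1 (t / s) (div_nonneg_of_nonpos ht hs.le) _ h
        rwa [smul_smul, ← Complex.ofReal_mul, div_mul_cancel₀ _ hs.ne] at this
    apply hw
    have h2 := hS.add_mem α 1 _ hR _ (hall (r₀ - R))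
    convert h2 using 1
    rw [hwdef, ← he]
    push_cast
    module
  have he0 : e ≠ 0 := by
    intro h
    apply hne (-1) (by norm_num)
    rw [h, smul_zero]
    exact hS.zero_mem α 1
  -- Adjoining the ray of `-w` forces `G w ≤ 0` for every functional positive on the new cone. The
  -- functional to be extended is `z e ↦ z`.
  let C' : Set (Matrix (Fin 1) (Fin 1) V) := {x | ∃ c ∈ C, ∃ t : ℝ, 0 ≤ t ∧ x = c - (t : ℂ) • w}
  have hCC' : ∀ c ∈ C, c ∈ C' := fun c hc => ⟨c, hc, 0, le_rfl, by simp⟩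
  obtain ⟨G, hGF, hG⟩ := exists_positive_extension C' (hCC' _ (hS.zero_mem α 1))
    (by
      rintro _ ⟨c, hc, t, ht, rfl⟩ _ ⟨d, hd, s, hs, rfl⟩
      refine ⟨c + d, hS.add_mem α 1 c hc d hd, t + s, add_nonneg ht hs, ?_⟩
      push_cast
      module)
    (by
      rintro r hr _ ⟨c, hc, t, ht, rfl⟩
      refine ⟨(r : ℂ) • c, hS.smul_mem α 1 r hr c hc, r * t, mul_nonneg hr ht, ?_⟩
      push_cast
      module)
    (by
      rintro _ ⟨c, hc, t, ht, rfl⟩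
      have hcs : IsSelfAdjoint c := hS.hermitian α 1 c hc
      have hws : IsSelfAdjoint w :=
        ((IsSelfAdjoint.smul (Complex.conj_ofReal r₀) hesa)).add hA
      exact hcs.sub (IsSelfAdjoint.smul (Complex.conj_ofReal t) hws))
    e hesa
    (fun a ha => (hS.order_unit α 1 a ha).imp fun r h => hCC' _ h.2)
    (Submodule.span ℂ {e}) (Submodule.mem_span_singleton_self e)
    (LinearEquiv.coord ℂ _ e he0).toLinearMap (by
      intro x hx
      set z := LinearEquiv.coord ℂ _ e he0 x with hz
      have hxz : (x : Matrix (Fin 1) (Fin 1) V) = z • e :=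
        (LinearEquiv.coord_apply_smul ℂ _ e he0 x).symm
      have hx2 : (x : Matrix (Fin 1) (Fin 1) V) + star (x : Matrix (Fin 1) (Fin 1) V) =
          ((2 * z.re : ℝ) : ℂ) • e := by
        rw [hxz, star_smul, hesa.star_eq, ← add_smul]
        congr 1
        apply Complex.ext <;> (simp; try ring)
      rw [hx2] at hx
      obtain ⟨c, hc, t, ht, hct⟩ := hx
      change 0 ≤ z.re
      by_contra! hneg
      -- A negative multiple of `e` equal to `c - t w` contradicts `hne` if `t = 0`; if `t > 0`,
      -- solving for `w` puts it in `C`.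
      rcases ht.eq_or_lt with rfl | ht
      · refine hne (2 * z.re) (by linarith) ?_
        rw [hct]
        simpa using hc
      · apply hw
        have h3 := hS.smul_mem α 1 t⁻¹ (inv_nonneg.2 ht.le) _
          (hS.add_mem α 1 _ hc _ (hS.smul_mem α 1 (-(2 * z.re)) (by linarith) _ heC))
        convert h3 using 1
        have h4 : c = ((2 * z.re : ℝ) : ℂ) • e + (t : ℂ) • w := by rw [hct]; module
        rw [h4, Complex.ofReal_neg, neg_smul, add_right_comm, add_neg_cancel, zero_add,
          smul_smul, ← Complex.ofReal_mul, inv_mul_cancel₀ ht.ne', Complex.ofReal_one, one_smul])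
  have hGe : G e = 1 := by
    rw [hGF ⟨e, Submodule.mem_span_singleton_self e⟩]
    exact LinearEquiv.coord_self ℂ _ e he0
  have hsing : ∀ B : Matrix (Fin 1) (Fin 1) V, Matrix.single 0 0 (B 0 0) = B := fun B => by
    ext i j
    rw [Subsingleton.elim i 0, Subsingleton.elim j 0]
    simp
  refine ⟨mapOfFunctional G, hS.isLUCPWrt_mapOfFunctional (fun B hB => hG _ (hCC' _ hB)) ?_, ?_⟩
  · ext i j
    rw [Subsingleton.elim i 0, Subsingleton.elim j 0, mapOfFunctional_apply]
    have : e 0 0 = S.unit := by simp [he, unitDiag]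
    rw [← this, hsing, hGe]
    simp
  · intro h
    have h1 : G A = 0 := by
      have := congrFun (congrFun h 0) 0
      rwa [mapOfFunctional_apply, hsing] at this
    have h2 := hG (-w) ⟨0, hS.zero_mem α 1, 1, zero_le_one, by simp⟩
    rw [hwdef, map_neg, map_add, map_smul, hGe, h1] at h2
    have h3 := (Complex.le_def.1 h2).1
    simp at h3
    linarith

/-- States separate the points of a local operator system. -/
theorem IsLocalOperatorSystem.eq_zero_of_forall_state (hS : S.IsLocalOperatorSystem) {v : V}
    (hv : ∀ α (φ : V →ₗ[ℂ] Matrix (Fin 1) (Fin 1) ℂ), S.IsLUCPWrt α φ → φ v = 0) : v = 0 := by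
  have key : ∀ v : V, IsSelfAdjoint v →
      (∀ α (φ : V →ₗ[ℂ] Matrix (Fin 1) (Fin 1) ℂ), S.IsLUCPWrt α φ → φ v = 0) → v = 0 := by
    intro v hsa hv
    have hmem : ∀ w : V, IsSelfAdjoint w →
        (∀ α (φ : V →ₗ[ℂ] Matrix (Fin 1) (Fin 1) ℂ), S.IsLUCPWrt α φ → φ w = 0) →
        ∀ α, (Matrix.of fun _ _ => w) ∈ S.cone α 1 := by
      intro w hw h0 α
      by_contra hcon
      obtain ⟨φ, hφ, hne⟩ := hS.exists_state_ne_zero (by ext i j; exact hw) hcon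
      exact hne (h0 α φ hφ)
    have h := hS.separating 1 (Matrix.of fun _ _ => v) fun α => ⟨hmem v hsa hv α,
      hmem (-v) hsa.neg (fun α φ hφ => by rw [map_neg, hv α φ hφ, neg_zero]) α⟩
    exact congrFun (congrFun h 0) 0
  have hstar : ∀ α (φ : V →ₗ[ℂ] Matrix (Fin 1) (Fin 1) ℂ), S.IsLUCPWrt α φ → φ (star v) = 0 :=
    fun α φ hφ => by rw [hφ.map_star hS, hv α φ hφ, star_zero]
  have h1 := key (v + star v) (IsSelfAdjoint.add_star_self v) fun α φ hφ => by
    rw [map_add, hv α φ hφ, hstar α φ hφ, add_zero]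
  have h2 := key (Complex.I • (v - star v)) (by
    simp only [IsSelfAdjoint, star_smul, star_sub, star_star, Complex.star_def, Complex.conj_I]
    module) fun α φ hφ => by
    rw [map_smul, map_sub, hv α φ hφ, hstar α φ hφ, sub_zero, smul_zero]
  rw [smul_eq_zero_iff_right Complex.I_ne_zero, sub_eq_zero] at h2
  rw [← h2, ← two_smul ℂ, smul_eq_zero_iff_right two_ne_zero] at h1
  exact h1

end Extension

end MatrixConeFamily

namespace MatrixConeFamily

/-! ### Slice maps and matrix entries of product maps -/

section Slices

variable {V W κ μ : Type*} [AddCommGroup V] [Module ℂ V] [AddCommGroup W] [Module ℂ W]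

/-- The slice map `f ⊗ id : V ⊗ W → W`. -/
def sliceLeft (f : V →ₗ[ℂ] ℂ) : V ⊗[ℂ] W →ₗ[ℂ] W :=
  (TensorProduct.lid ℂ W).toLinearMap ∘ₗ TensorProduct.map f LinearMap.id

@[simp]
theorem sliceLeft_tmul (f : V →ₗ[ℂ] ℂ) (v : V) (w : W) : sliceLeft f (v ⊗ₜ[ℂ] w) = f v • w := rfl

/-- The slice map `id ⊗ g : V ⊗ W → V`. -/
def sliceRight (g : W →ₗ[ℂ] ℂ) : V ⊗[ℂ] W →ₗ[ℂ] V :=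
  (TensorProduct.rid ℂ V).toLinearMap ∘ₗ TensorProduct.map LinearMap.id g

@[simp]
theorem sliceRight_tmul (g : W →ₗ[ℂ] ℂ) (v : V) (w : W) : sliceRight g (v ⊗ₜ[ℂ] w) = g w • v := rfl

/-- The matrix entries of a matrix-valued linear map. -/
def entryMap (φ : V →ₗ[ℂ] Matrix κ κ ℂ) (i j : κ) : V →ₗ[ℂ] ℂ :=
  Matrix.entryLinearMap ℂ ℂ i j ∘ₗ φ

@[simp]
theorem entryMap_apply (φ : V →ₗ[ℂ] Matrix κ κ ℂ) (i j : κ) (v : V) :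
    entryMap φ i j v = φ v i j := rfl

theorem tensorMap_tmul (φ : V →ₗ[ℂ] Matrix κ κ ℂ) (ψ : W →ₗ[ℂ] Matrix μ μ ℂ) (v : V) (w : W) :
    tensorMap φ ψ (v ⊗ₜ[ℂ] w) = Matrix.kroneckerMap (· * ·) (φ v) (ψ w) := rfl

@[simp]
theorem tensorMap_tmul_apply (φ : V →ₗ[ℂ] Matrix κ κ ℂ) (ψ : W →ₗ[ℂ] Matrix μ μ ℂ) (v : V) (w : W)
    (a b : κ × μ) : tensorMap φ ψ (v ⊗ₜ[ℂ] w) a b = φ v a.1 b.1 * ψ w a.2 b.2 := rfl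

/-- Evaluates `φ ⊗ ψ` in two stages, first `φ` and then `ψ`. Associativity depends on this when the
second map is not itself a product. -/
theorem tensorMap_apply_eq_right (φ : V →ₗ[ℂ] Matrix κ κ ℂ) (ψ : W →ₗ[ℂ] Matrix μ μ ℂ)
    (x : V ⊗[ℂ] W) (a b : κ × μ) :
    tensorMap φ ψ x a b = ψ (sliceLeft (entryMap φ a.1 b.1) x) a.2 b.2 := by
  induction x with
  | zero => simp
  | tmul v w => simp
  | add x y hx hy => simp [hx, hy]

theorem tensorMap_apply_eq_left (φ : V →ₗ[ℂ] Matrix κ κ ℂ) (ψ : W →ₗ[ℂ] Matrix μ μ ℂ)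
    (x : V ⊗[ℂ] W) (a b : κ × μ) :
    tensorMap φ ψ x a b = φ (sliceRight (entryMap ψ a.2 b.2) x) a.1 b.1 := by
  induction x with
  | zero => simp
  | tmul v w => simp [mul_comm]
  | add x y hx hy => simp [hx, hy]

theorem map_sliceRight (f : V →ₗ[ℂ] ℂ) (g : W →ₗ[ℂ] ℂ) (x : V ⊗[ℂ] W) :
    f (sliceRight g x) = g (sliceLeft f x) := by
  induction x with
  | zero => simp
  | tmul v w => simp [mul_comm]
  | add x y hx hy => simp [hx, hy]

/-- Slices by all functionals separate the points of a tensor product. -/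
theorem eq_zero_of_forall_sliceLeft {x : V ⊗[ℂ] W} (hx : ∀ f : V →ₗ[ℂ] ℂ, sliceLeft f x = 0) :
    x = 0 := by
  classical
  let b := Module.Basis.ofVectorSpace ℂ V
  apply (TensorProduct.equivFinsuppOfBasisLeft (N := W) b).injective
  rw [map_zero]
  ext i
  have : ∀ y : V ⊗[ℂ] W, TensorProduct.equivFinsuppOfBasisLeft b y i = sliceLeft (b.coord i) y := by
    intro y
    induction y with
    | zero => simp
    | tmul v w => simp
    | add x y hx hy => simp [hx, hy]
  rw [this, hx]
  rfl

/-- The map `V → M_κ'` obtained from `V → M_κ` by relabelling. -/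
def reindexMap {κ' : Type*} (e : κ ≃ κ') (φ : V →ₗ[ℂ] Matrix κ κ ℂ) : V →ₗ[ℂ] Matrix κ' κ' ℂ :=
  (Matrix.reindexLinearEquiv ℂ ℂ e e).toLinearMap ∘ₗ φ

@[simp]
theorem reindexMap_apply {κ' : Type*} (e : κ ≃ κ') (φ : V →ₗ[ℂ] Matrix κ κ ℂ) (v : V) (i j : κ') :
    reindexMap e φ v i j = φ v (e.symm i) (e.symm j) := rfl

theorem tensorMap_reindexMap {κ' μ' : Type*} (e : κ ≃ κ') (f : μ ≃ μ') (φ : V →ₗ[ℂ] Matrix κ κ ℂ)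
    (ψ : W →ₗ[ℂ] Matrix μ μ ℂ) (x : V ⊗[ℂ] W) (a b : κ' × μ') :
    tensorMap (reindexMap e φ) (reindexMap f ψ) x a b =
      tensorMap φ ψ x (e.symm a.1, f.symm a.2) (e.symm b.1, f.symm b.2) := by
  induction x with
  | zero => simp
  | tmul v w => simp
  | add x y hx hy => simp [hx, hy]

end Slices

theorem IsLUCPWrt.reindexMap {V Γ κ κ' : Type*} [Fintype κ] [DecidableEq κ] [Fintype κ']
    [DecidableEq κ'] [AddCommGroup V] [Module ℂ V] {S : MatrixConeFamily V Γ} {α : Γ}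
    {φ : V →ₗ[ℂ] Matrix κ κ ℂ} (hφ : S.IsLUCPWrt α φ) (e : κ ≃ κ') :
    S.IsLUCPWrt α (reindexMap e φ) where
  map_unit := by
    ext i j
    simp [hφ.map_unit, Matrix.one_apply]
  map_cone n A hA := (hφ.map_cone n A hA).submatrix (Prod.map id e.symm)

theorem IsLUCPWrt.comp {V Γ W Λ κ : Type*} [Fintype κ] [DecidableEq κ] [AddCommGroup V]
    [Module ℂ V] [AddCommGroup W] [Module ℂ W] {S : MatrixConeFamily V Γ}
    {T : MatrixConeFamily W Λ} {α : Γ} {β : Λ} {φ : W →ₗ[ℂ] Matrix κ κ ℂ}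
    (hφ : T.IsLUCPWrt β φ) {f : V →ₗ[ℂ] W} (hf : f S.unit = T.unit)
    (hf' : ∀ n, ∀ A ∈ S.cone α n, A.map f ∈ T.cone β n) : S.IsLUCPWrt α (φ ∘ₗ f) where
  map_unit := by rw [LinearMap.comp_apply, hf, hφ.map_unit]
  map_cone n A hA := hφ.map_cone n _ (hf' n A hA)

/-! ### Elementary properties of the lmin cones -/

section Lmin

variable {V Γ W Λ : Type*}
  [AddCommGroup V] [Module ℂ V] [StarAddMonoid V] [StarModule ℂ V]
  [AddCommGroup W] [Module ℂ W] [StarAddMonoid W] [StarModule ℂ W]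
  {S : MatrixConeFamily V Γ} {T : MatrixConeFamily W Λ}

theorem tensorMap_unit {κ μ : Type*} [Fintype κ] [DecidableEq κ] [Fintype μ] [DecidableEq μ]
    {α : Γ} {β : Λ} {φ : V →ₗ[ℂ] Matrix κ κ ℂ} {ψ : W →ₗ[ℂ] Matrix μ μ ℂ}
    (hφ : S.IsLUCPWrt α φ) (hψ : T.IsLUCPWrt β ψ) :
    tensorMap φ ψ (S.lmin T).unit = 1 := by
  change tensorMap φ ψ (S.unit ⊗ₜ[ℂ] T.unit) = 1
  rw [tensorMap_tmul, hφ.map_unit, hψ.map_unit]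
  exact Matrix.one_kronecker_one

theorem comp_map_unitDiag {V Γ κ : Type*} [DecidableEq κ] [AddCommGroup V] [Module ℂ V]
    {S : MatrixConeFamily V Γ} {φ : V →ₗ[ℂ] Matrix κ κ ℂ} (hφ : φ S.unit = 1) (n : ℕ) :
    Matrix.comp (Fin n) (Fin n) κ κ ℂ ((S.unitDiag n).map φ) = 1 := by
  ext ⟨p, i⟩ ⟨q, j⟩
  by_cases h : p = q
  · subst h
    simp [unitDiag, hφ, Matrix.one_apply]
  · simp [unitDiag, h]

theorem tensorMap_star {κ μ : Type*} {φ : V →ₗ[ℂ] Matrix κ κ ℂ} {ψ : W →ₗ[ℂ] Matrix μ μ ℂ}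
    (hφ : ∀ v, φ (star v) = star (φ v)) (hψ : ∀ w, ψ (star w) = star (ψ w)) (x : V ⊗[ℂ] W) :
    tensorMap φ ψ (star x) = star (tensorMap φ ψ x) := by
  induction x with
  | zero => simp
  | tmul v w =>
    ext a b
    simp [hφ, hψ, Matrix.star_apply]
  | add x y hx hy => simp [hx, hy]

/-- Relabelling frees the test maps from the index sets `Fin k`. This matters for iterated tensor
products, where product maps have values in matrices indexed by `κ × μ`. -/
theorem lmin_posSemidef {κ μ : Type*} [Fintype κ] [DecidableEq κ] [Fintype μ] [DecidableEq μ]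
    {γ : Γ × Λ} {n : ℕ} {A : Matrix (Fin n) (Fin n) (V ⊗[ℂ] W)} (hA : A ∈ (S.lmin T).cone γ n)
    {φ : V →ₗ[ℂ] Matrix κ κ ℂ} {ψ : W →ₗ[ℂ] Matrix μ μ ℂ}
    (hφ : S.IsLUCPWrt γ.1 φ) (hψ : T.IsLUCPWrt γ.2 ψ) :
    (Matrix.comp (Fin n) (Fin n) (κ × μ) (κ × μ) ℂ (A.map (tensorMap φ ψ))).PosSemidef := by
  have e := Fintype.equivFin κ
  have f := Fintype.equivFin μ
  have h := (hA.2 _ _ _ _ (hφ.reindexMap e) (hψ.reindexMap f)).submatrix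
    (Prod.map id (Prod.map e f))
  convert h using 1
  ext ⟨p, i⟩ ⟨q, j⟩
  simp [tensorMap_reindexMap]

theorem isLUCPWrt_tensorMap {κ μ : Type*} [Fintype κ] [DecidableEq κ] [Fintype μ] [DecidableEq μ]
    {α : Γ} {β : Λ} {φ : V →ₗ[ℂ] Matrix κ κ ℂ} {ψ : W →ₗ[ℂ] Matrix μ μ ℂ}
    (hφ : S.IsLUCPWrt α φ) (hψ : T.IsLUCPWrt β ψ) :
    (S.lmin T).IsLUCPWrt (α, β) (tensorMap φ ψ) where
  map_unit := tensorMap_unit hφ hψ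
  map_cone _ _ hA := lmin_posSemidef hA hφ hψ

theorem IsLUCPWrt.mono {κ : Type*} [Fintype κ] [DecidableEq κ] {V Γ : Type*} [AddCommGroup V]
    [Module ℂ V] {S : MatrixConeFamily V Γ} {α α' : Γ}
    (h : ∀ n, S.cone α' n ⊆ S.cone α n) {φ : V →ₗ[ℂ] Matrix κ κ ℂ} (hφ : S.IsLUCPWrt α φ) :
    S.IsLUCPWrt α' φ :=
  ⟨hφ.map_unit, fun n A hA => hφ.map_cone n A (h n hA)⟩

theorem lmin_cone_mono {α α' : Γ} {β β' : Λ} (hα : ∀ n, S.cone α' n ⊆ S.cone α n)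
    (hβ : ∀ n, T.cone β' n ⊆ T.cone β n) (n : ℕ) :
    (S.lmin T).cone (α', β') n ⊆ (S.lmin T).cone (α, β) n :=
  fun _ hA => ⟨hA.1, fun k m φ ψ hφ hψ => hA.2 k m φ ψ (hφ.mono hα) (hψ.mono hβ)⟩

theorem compression_isHermitian {n m : ℕ} (X : Matrix (Fin n) (Fin m) ℂ)
    {A : Matrix (Fin n) (Fin n) V} (hA : A.IsHermitian) : (compression X A).IsHermitian := by
  ext i j
  simp only [Matrix.conjTranspose_apply, compression, Matrix.of_apply, star_sum, star_smul,
    hA.apply, star_mul', star_star]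
  rw [Finset.sum_comm]
  simp only [mul_comm]

theorem comp_map_compression {V κ : Type*} [AddCommGroup V] [Module ℂ V] [Fintype κ]
    [DecidableEq κ] (φ : V →ₗ[ℂ] Matrix κ κ ℂ) {n m : ℕ}
    (X : Matrix (Fin n) (Fin m) ℂ) (A : Matrix (Fin n) (Fin n) V) :
    Matrix.comp (Fin m) (Fin m) κ κ ℂ ((compression X A).map φ) =
      (Matrix.kroneckerMap (· * ·) X (1 : Matrix κ κ ℂ))ᴴ *
        Matrix.comp (Fin n) (Fin n) κ κ ℂ (A.map φ) *
          Matrix.kroneckerMap (· * ·) X (1 : Matrix κ κ ℂ) := by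
  ext ⟨p, i⟩ ⟨q, j⟩
  simp only [Matrix.comp_apply, Matrix.map_apply, compression, Matrix.of_apply, map_sum, map_smul,
    Matrix.sum_apply, Matrix.smul_apply, Matrix.mul_apply, Fintype.sum_prod_type,
    Matrix.kroneckerMap_apply, Matrix.conjTranspose_apply, Matrix.one_apply, star_mul', smul_eq_mul]
  simp only [mul_ite, mul_one, mul_zero, Finset.sum_ite_eq', Finset.mem_univ, if_true,
    apply_ite star, star_one, star_zero, ite_mul, zero_mul, Finset.sum_mul]
  rw [Finset.sum_comm]
  simp only [mul_right_comm]

theorem eq_zero_of_posSemidef_neg {κ : Type*} [Fintype κ] {M : Matrix κ κ ℂ} (h : M.PosSemidef)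
    (h' : (-M).PosSemidef) : M = 0 := by
  open scoped MatrixOrder in
  exact le_antisymm (neg_nonneg.1 (Matrix.nonneg_iff_posSemidef.2 h'))
    (Matrix.nonneg_iff_posSemidef.2 h)

/-- Products of states separate the points of `V ⊗ W`. -/
theorem eq_zero_of_forall_tensorMap (hS : S.IsLocalOperatorSystem)
    (hT : T.IsLocalOperatorSystem) {x : V ⊗[ℂ] W}
    (hx : ∀ α β (φ : V →ₗ[ℂ] Matrix (Fin 1) (Fin 1) ℂ) (ψ : W →ₗ[ℂ] Matrix (Fin 1) (Fin 1) ℂ),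
      S.IsLUCPWrt α φ → T.IsLUCPWrt β ψ → tensorMap φ ψ x = 0) : x = 0 := by
  refine eq_zero_of_forall_sliceLeft fun f => hT.eq_zero_of_forall_state fun β ψ hψ => ?_
  ext i j
  -- With `ψ` fixed, the states of `V` kill the slice by `ψ`, so it vanishes; then `ψ` kills the
  -- slice by an arbitrary functional `f`.
  have h : sliceRight (entryMap ψ i j) x = 0 := hS.eq_zero_of_forall_state fun α φ hφ => by
    ext p q
    have := congrFun (congrFun (hx α β φ ψ hφ hψ) (p, i)) (q, j)
    rwa [tensorMap_apply_eq_left] at this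
  have h2 := map_sliceRight f (entryMap ψ i j) x
  rw [h, map_zero] at h2
  exact h2.symm

theorem posSemidef_of_forall_add {κ : Type*} [Fintype κ] [DecidableEq κ] {M : Matrix κ κ ℂ}
    (h : ∀ r : ℝ, 0 < r → ((r : ℂ) • 1 + M).PosSemidef) : M.PosSemidef := by
  refine Matrix.PosSemidef.of_dotProduct_mulVec_nonneg ?_ fun x => ?_
  · have h1 := (h 1 one_pos).isHermitian
    rw [Complex.ofReal_one, one_smul] at h1
    simpa using h1.sub Matrix.isHermitian_one
  · have hlim : Filter.Tendsto (fun r : ℝ => (r : ℂ) * (star x ⬝ᵥ x) + star x ⬝ᵥ M *ᵥ x)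
        (nhdsWithin 0 (Set.Ioi 0)) (nhds (((0 : ℝ) : ℂ) * (star x ⬝ᵥ x) + star x ⬝ᵥ M *ᵥ x)) := by
      refine Filter.Tendsto.mono_left (Continuous.tendsto (by fun_prop) 0) nhdsWithin_le_nhds
    rw [Complex.ofReal_zero, zero_mul, zero_add] at hlim
    refine ge_of_tendsto hlim ?_
    filter_upwards [self_mem_nhdsWithin] with r hr
    have := (h r hr).dotProduct_mulVec_nonneg x
    simpa [Matrix.add_mulVec, dotProduct_add, Matrix.smul_mulVec, dotProduct_smul] using this

end Lmin

end MatrixConeFamily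

namespace MatrixConeFamily

/-! ### The order unit and the tensor product axioms -/

section OrderUnit

/-- Positivity of the form at `x - y` bounds `2 Re⟨x, M y⟩` by `⟨x, M x⟩ + ⟨y, M y⟩`, and each term
is controlled by `M ≤ R`. The sharp constant `R / 2` is not needed. -/
theorem re_star_dotProduct_mulVec_le {κ : Type*} [Fintype κ] [DecidableEq κ] {M : Matrix κ κ ℂ}
    (hM : M.PosSemidef) {R : ℝ} (hR : ((R : ℂ) • (1 : Matrix κ κ ℂ) - M).PosSemidef)
    (x y : κ → ℂ) :
    (star x ⬝ᵥ M *ᵥ y).re ≤ R * ((star x ⬝ᵥ x).re + (star y ⬝ᵥ y).re) := by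
  have hle : ∀ z : κ → ℂ, (star z ⬝ᵥ M *ᵥ z).re ≤ R * (star z ⬝ᵥ z).re := by
    intro z
    have := (Complex.le_def.1 (hR.dotProduct_mulVec_nonneg z)).1
    simp [Matrix.sub_mulVec, dotProduct_sub, Matrix.smul_mulVec, dotProduct_smul] at this
    exact this
  have hnn : ∀ z : κ → ℂ, 0 ≤ (star z ⬝ᵥ M *ᵥ z).re := fun z =>
    (Complex.le_def.1 (hM.dotProduct_mulVec_nonneg z)).1
  have hsymm : (star y ⬝ᵥ M *ᵥ x).re = (star x ⬝ᵥ M *ᵥ y).re := by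
    have h : star (star x ⬝ᵥ M *ᵥ y) = star y ⬝ᵥ M *ᵥ x := by
      rw [Matrix.star_dotProduct, star_star, Matrix.star_mulVec, hM.isHermitian.eq,
        ← Matrix.dotProduct_mulVec]
    rw [← h]
    simp
  have h1 := hnn (x - y)
  simp only [star_sub, Matrix.mulVec_sub, dotProduct_sub, sub_dotProduct, Complex.sub_re] at h1
  have := hle x
  have := hle y
  have := hnn x
  have := hnn y
  linarith

theorem star_dotProduct_comp_mulVec_eq_sum {κ : Type*} [Fintype κ] {n : ℕ}
    (M : Matrix (Fin n) (Fin n) (Matrix κ κ ℂ)) (x : Fin n × κ → ℂ) :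
    star x ⬝ᵥ (Matrix.comp (Fin n) (Fin n) κ κ ℂ M *ᵥ x) =
      ∑ p, ∑ q, star (fun i => x (p, i)) ⬝ᵥ M p q *ᵥ fun i => x (q, i) := by
  simp only [dotProduct, mulVec, Fintype.sum_prod_type, Finset.mul_sum, Matrix.comp_apply,
    Pi.star_apply]
  exact Finset.sum_congr rfl fun p _ => Finset.sum_comm

/-- Use `rs 1 - a ⊗ b = r 1 ⊗ (s 1 - b) + (r 1 - a) ⊗ b`, a sum of Kronecker products of positive
matrices. -/
theorem kroneckerMap_one_sub_posSemidef {κ μ : Type*} [Fintype κ] [DecidableEq κ] [Fintype μ]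
    [DecidableEq μ] {a : Matrix κ κ ℂ} {b : Matrix μ μ ℂ} {r s : ℝ} (hr : 0 ≤ r)
    (ha' : ((r : ℂ) • (1 : Matrix κ κ ℂ) - a).PosSemidef)
    (hb : b.PosSemidef) (hb' : ((s : ℂ) • (1 : Matrix μ μ ℂ) - b).PosSemidef) :
    (((r * s : ℝ) : ℂ) • (1 : Matrix (κ × μ) (κ × μ) ℂ) -
      Matrix.kroneckerMap (· * ·) a b).PosSemidef := by
  have h1 := (Matrix.PosSemidef.one (n := κ) (R := ℂ)).smul (Complex.zero_le_real.2 hr)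
  suffices h : ((r * s : ℝ) : ℂ) • (1 : Matrix (κ × μ) (κ × μ) ℂ) - Matrix.kroneckerMap (· * ·) a b =
      Matrix.kroneckerMap (· * ·) ((r : ℂ) • (1 : Matrix κ κ ℂ)) ((s : ℂ) • (1 : Matrix μ μ ℂ) - b) +
        Matrix.kroneckerMap (· * ·) ((r : ℂ) • (1 : Matrix κ κ ℂ) - a) b by
    rw [h]
    exact (h1.kronecker hb').add (ha'.kronecker hb)
  ext ⟨i, p⟩ ⟨j, q⟩
  simp only [Matrix.sub_apply, Matrix.add_apply, Matrix.smul_apply, Matrix.kroneckerMap_apply,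
    smul_eq_mul, Matrix.one_apply, Prod.mk.injEq]
  push_cast
  split_ifs <;> first | (exfalso; tauto) | ring

variable {V Γ W Λ : Type*}
  [AddCommGroup V] [Module ℂ V] [StarAddMonoid V] [StarModule ℂ V]
  [AddCommGroup W] [Module ℂ W] [StarAddMonoid W] [StarModule ℂ W]
  {S : MatrixConeFamily V Γ} {T : MatrixConeFamily W Λ}

theorem IsLUCPWrt.apply_posSemidef {V Γ κ : Type*} [Fintype κ] [DecidableEq κ] [AddCommGroup V]
    [Module ℂ V] {S : MatrixConeFamily V Γ} {α : Γ} {φ : V →ₗ[ℂ] Matrix κ κ ℂ}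
    (hφ : S.IsLUCPWrt α φ) {A : Matrix (Fin 1) (Fin 1) V} (hA : A ∈ S.cone α 1) :
    (φ (A 0 0)).PosSemidef :=
  (hφ.map_cone 1 A hA).submatrix fun i => ((0 : Fin 1), i)

/-- Every local operator system is spanned by the positive elements of each of its cones. -/
theorem IsLocalOperatorSystem.mem_span_cone (hS : S.IsLocalOperatorSystem) (α : Γ) (v : V) :
    v ∈ Submodule.span ℂ ((fun A : Matrix (Fin 1) (Fin 1) V => A 0 0) '' S.cone α 1) := by
  have key : ∀ v : V, IsSelfAdjoint v →
      v ∈ Submodule.span ℂ ((fun A : Matrix (Fin 1) (Fin 1) V => A 0 0) '' S.cone α 1) := by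
    intro v hv
    obtain ⟨r, -, hr⟩ := hS.order_unit α 1 (Matrix.of fun _ _ => v) (by ext i j; exact hv)
    have h1 := Submodule.subset_span (R := ℂ)
      (Set.mem_image_of_mem (fun A : Matrix (Fin 1) (Fin 1) V => A 0 0) hr)
    have h2 := Submodule.subset_span (R := ℂ)
      (Set.mem_image_of_mem (fun A : Matrix (Fin 1) (Fin 1) V => A 0 0) (hS.unitDiag_mem α 1))
    have h3 := Submodule.sub_mem _ (Submodule.smul_mem _ (r : ℂ) h2) h1
    simpa using h3
  rw [← realPart_add_I_smul_imaginaryPart v]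
  exact Submodule.add_mem _ (key _ (realPart v).2)
    (Submodule.smul_mem _ _ (key _ (imaginaryPart v).2))

/-- The elements of `V ⊗ W` on which the products of local unital completely positive maps are
uniformly bounded. -/
def boundedElements (S : MatrixConeFamily V Γ) (T : MatrixConeFamily W Λ) (α : Γ) (β : Λ) :
    Submodule ℂ (V ⊗[ℂ] W) where
  carrier := {x | ∃ r : ℝ, 0 ≤ r ∧ ∀ (k m : ℕ)
    (φ : V →ₗ[ℂ] Matrix (Fin k) (Fin k) ℂ) (ψ : W →ₗ[ℂ] Matrix (Fin m) (Fin m) ℂ),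
    S.IsLUCPWrt α φ → T.IsLUCPWrt β ψ → ∀ ξ η : Fin k × Fin m → ℂ,
      (star ξ ⬝ᵥ tensorMap φ ψ x *ᵥ η).re ≤ r * ((star ξ ⬝ᵥ ξ).re + (star η ⬝ᵥ η).re)}
  zero_mem' := ⟨0, le_rfl, by simp⟩
  add_mem' := by
    rintro x y ⟨r, hr, hx⟩ ⟨s, hs, hy⟩
    refine ⟨r + s, add_nonneg hr hs, fun k m φ ψ hφ hψ ξ η => ?_⟩
    have h1 := hx k m φ ψ hφ hψ ξ η
    have h2 := hy k m φ ψ hφ hψ ξ η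
    rw [map_add, Matrix.add_mulVec, dotProduct_add, Complex.add_re]
    linarith
  smul_mem' := by
    rintro c x ⟨r, hr, hx⟩
    -- The scalar is absorbed into `η`, which multiplies its squared norm by `|c|²`; adding `1` also
    -- covers the `ξ` term.
    refine ⟨r * (1 + Complex.normSq c), mul_nonneg hr (add_nonneg zero_le_one
      (Complex.normSq_nonneg c)), fun k m φ ψ hφ hψ ξ η => ?_⟩
    have h1 := hx k m φ ψ hφ hψ ξ (c • η)
    have h2 : (star (c • η) ⬝ᵥ (c • η)).re = Complex.normSq c * (star η ⬝ᵥ η).re := by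
      rw [star_smul, smul_dotProduct, dotProduct_smul, smul_smul, Complex.star_def,
        ← Complex.normSq_eq_conj_mul_self, smul_eq_mul, Complex.re_ofReal_mul]
    have hξ : 0 ≤ (star ξ ⬝ᵥ ξ).re := (Complex.le_def.1 (dotProduct_star_self_nonneg ξ)).1
    have hη : 0 ≤ (star η ⬝ᵥ η).re := (Complex.le_def.1 (dotProduct_star_self_nonneg η)).1
    rw [map_smul, Matrix.smul_mulVec, ← Matrix.mulVec_smul]
    rw [h2] at h1
    refine h1.trans ?_
    rw [mul_assoc]
    refine mul_le_mul_of_nonneg_left ?_ hr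
    have := mul_nonneg (Complex.normSq_nonneg c) hξ
    linarith

/-- Positive elements span each factor, and for positive `a ≤ r e`, `b ≤ s e` unitality gives the
bound `rs` on `φ(a) ⊗ ψ(b)`, independent of `φ` and `ψ`. -/
theorem mem_boundedElements (hS : S.IsLocalOperatorSystem) (hT : T.IsLocalOperatorSystem)
    (α : Γ) (β : Λ) (x : V ⊗[ℂ] W) : x ∈ boundedElements S T α β := by
  induction x with
  | zero => exact Submodule.zero_mem _
  | add x y hx hy => exact Submodule.add_mem _ hx hy
  | tmul v w =>
    induction hS.mem_span_cone α v using Submodule.span_induction with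
    | zero => rw [TensorProduct.zero_tmul]; exact Submodule.zero_mem _
    | add x y _ _ hx hy => rw [TensorProduct.add_tmul]; exact Submodule.add_mem _ hx hy
    | smul c x _ hx => rw [← TensorProduct.smul_tmul']; exact Submodule.smul_mem _ _ hx
    | mem v hv =>
      obtain ⟨A, hA, rfl⟩ := hv
      induction hT.mem_span_cone β w using Submodule.span_induction with
      | zero => rw [TensorProduct.tmul_zero]; exact Submodule.zero_mem _
      | add x y _ _ hx hy => rw [TensorProduct.tmul_add]; exact Submodule.add_mem _ hx hy
      | smul c x _ hx => rw [TensorProduct.tmul_smul]; exact Submodule.smul_mem _ _ hx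
      | mem w hw =>
        obtain ⟨B, hB, rfl⟩ := hw
        obtain ⟨r, hr, hAr⟩ := hS.order_unit α 1 A (hS.hermitian α 1 A hA)
        obtain ⟨s, hs, hBs⟩ := hT.order_unit β 1 B (hT.hermitian β 1 B hB)
        refine ⟨r * s, (mul_pos hr hs).le, fun k m φ ψ hφ hψ ξ η => ?_⟩
        have ha := hφ.apply_posSemidef hA
        have hb := hψ.apply_posSemidef hB
        have ha' := hφ.apply_posSemidef hAr
        have hb' := hψ.apply_posSemidef hBs
        simp only [unitDiag, Matrix.sub_apply, Matrix.smul_apply, Matrix.diagonal_apply_eq,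
          map_sub, map_smul, hφ.map_unit, hψ.map_unit] at ha' hb'
        rw [tensorMap_tmul]
        exact re_star_dotProduct_mulVec_le (ha.kronecker hb)
          (kroneckerMap_one_sub_posSemidef hr.le ha' hb hb') ξ η

theorem lmin_order_unit (hS : S.IsLocalOperatorSystem) (hT : T.IsLocalOperatorSystem)
    (γ : Γ × Λ) (n : ℕ) (A : Matrix (Fin n) (Fin n) (V ⊗[ℂ] W)) (hA : A.IsHermitian) :
    ∃ r : ℝ, 0 < r ∧ (r : ℂ) • (S.lmin T).unitDiag n - A ∈ (S.lmin T).cone γ n := by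
  choose r hr hbound using fun p q => mem_boundedElements hS hT γ.1 γ.2 (A p q)
  -- The `(p, q)` block contributes at most `r p q (‖x_p‖² + ‖x_q‖²) ≤ 2 (r p q) ‖x‖²`. The unit is
  -- later scaled by `R + 1` only to have a strictly positive constant.
  set R := 2 * ∑ p, ∑ q, r p q with hRdef
  have hR0 : 0 ≤ R := mul_nonneg zero_le_two
    (Finset.sum_nonneg fun p _ => Finset.sum_nonneg fun q _ => hr p q)
  have hunit : ((S.lmin T).unitDiag n).IsHermitian :=
    Matrix.isHermitian_diagonal_of_self_adjoint _ (funext fun _ => by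
      change star (S.unit ⊗ₜ[ℂ] T.unit) = S.unit ⊗ₜ[ℂ] T.unit
      rw [TensorProduct.star_tmul, hS.unit_hermitian, hT.unit_hermitian])
  have hherm : (((R + 1 : ℝ) : ℂ) • (S.lmin T).unitDiag n - A).IsHermitian :=
    IsSelfAdjoint.sub (IsSelfAdjoint.smul (Complex.conj_ofReal _) hunit) hA
  refine ⟨R + 1, by linarith, hherm, fun k m φ ψ hφ hψ => ?_⟩
  have hstar := tensorMap_star (hφ.map_star hS) (hψ.map_star hT)
  have hM := comp_map_isHermitian _ hstar hherm
  have hA' := comp_map_isHermitian _ hstar hA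
  refine Matrix.PosSemidef.of_dotProduct_mulVec_nonneg hM fun x => ?_
  rw [Complex.le_def]
  refine ⟨?_, (hM.im_star_dotProduct_mulVec_self x).symm⟩
  have hsub : Matrix.comp (Fin n) (Fin n) (Fin k × Fin m) (Fin k × Fin m) ℂ
      ((((R + 1 : ℝ) : ℂ) • (S.lmin T).unitDiag n - A).map (tensorMap φ ψ)) =
      ((R + 1 : ℝ) : ℂ) • 1 -
        Matrix.comp (Fin n) (Fin n) (Fin k × Fin m) (Fin k × Fin m) ℂ (A.map (tensorMap φ ψ)) := by
    rw [← comp_map_unitDiag (tensorMap_unit hφ hψ)]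
    ext ⟨p, i⟩ ⟨q, j⟩
    simp
  have hnn : ∀ p, 0 ≤ (star (fun i => x (p, i)) ⬝ᵥ fun i => x (p, i)).re := fun p =>
    (Complex.le_def.1 (dotProduct_star_self_nonneg _)).1
  have hx : (star x ⬝ᵥ x).re = ∑ p, (star (fun i => x (p, i)) ⬝ᵥ fun i => x (p, i)).re := by
    simp [dotProduct, Fintype.sum_prod_type]
  have hpx : ∀ p, (star (fun i => x (p, i)) ⬝ᵥ fun i => x (p, i)).re ≤ (star x ⬝ᵥ x).re := fun p => by
    rw [hx]
    exact Finset.single_le_sum (fun p _ => hnn p) (Finset.mem_univ p)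
  have hx0 : 0 ≤ (star x ⬝ᵥ x).re := (Complex.le_def.1 (dotProduct_star_self_nonneg x)).1
  have hbd : (star x ⬝ᵥ Matrix.comp (Fin n) (Fin n) (Fin k × Fin m) (Fin k × Fin m) ℂ
      (A.map (tensorMap φ ψ)) *ᵥ x).re ≤ R * (star x ⬝ᵥ x).re := by
    rw [star_dotProduct_comp_mulVec_eq_sum, Complex.re_sum, hRdef, Finset.mul_sum, Finset.sum_mul]
    refine Finset.sum_le_sum fun p _ => ?_
    rw [Complex.re_sum, Finset.mul_sum, Finset.sum_mul]
    refine Finset.sum_le_sum fun q _ => (hbound p q k m φ ψ hφ hψ _ _).trans ?_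
    have := mul_le_mul_of_nonneg_left (add_le_add (hpx p) (hpx q)) (hr p q)
    linarith
  rw [hsub, Matrix.sub_mulVec, dotProduct_sub, Matrix.smul_mulVec, dotProduct_smul,
    Matrix.one_mulVec, Complex.sub_re, smul_eq_mul, Complex.re_ofReal_mul, Complex.zero_re]
  linarith

theorem lmin_isLocalOperatorSystem (hS : S.IsLocalOperatorSystem) (hT : T.IsLocalOperatorSystem) :
    (S.lmin T).IsLocalOperatorSystem where
  nonempty := ⟨(hS.nonempty.some, hT.nonempty.some)⟩
  filtered := by
    rintro ⟨α, β⟩ ⟨α', β'⟩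
    obtain ⟨a, ha⟩ := hS.filtered α α'
    obtain ⟨b, hb⟩ := hT.filtered β β'
    exact ⟨(a, b), fun n => Set.subset_inter
      (lmin_cone_mono (fun n => (ha n).trans Set.inter_subset_left)
        (fun n => (hb n).trans Set.inter_subset_left) n)
      (lmin_cone_mono (fun n => (ha n).trans Set.inter_subset_right)
        (fun n => (hb n).trans Set.inter_subset_right) n)⟩
  hermitian _ _ _ hA := hA.1
  zero_mem α n := ⟨Matrix.isHermitian_zero, fun k m φ ψ _ _ => by
    convert Matrix.PosSemidef.zero using 1
    ext a b
    simp⟩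
  add_mem α n A hA B hB := ⟨hA.1.add hB.1, fun k m φ ψ hφ hψ => by
    convert (hA.2 k m φ ψ hφ hψ).add (hB.2 k m φ ψ hφ hψ) using 1
    ext a b
    simp⟩
  smul_mem α n r hr A hA := ⟨IsSelfAdjoint.smul (Complex.conj_ofReal r) hA.1,
    fun k m φ ψ hφ hψ => by
      convert (hA.2 k m φ ψ hφ hψ).smul (Complex.zero_le_real.2 hr) using 1
      ext a b
      simp⟩
  separating n A hA := by
    ext p q
    refine eq_zero_of_forall_tensorMap hS hT fun α β φ ψ hφ hψ => ?_
    have h := eq_zero_of_posSemidef_neg ((hA (α, β)).1.2 1 1 φ ψ hφ hψ) (by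
      convert (hA (α, β)).2.2 1 1 φ ψ hφ hψ using 1
      ext a b
      simp)
    ext a b
    exact congrFun (congrFun h (p, a)) (q, b)
  compression_mem α n m X A hA := ⟨compression_isHermitian X hA.1, fun k l φ ψ hφ hψ => by
    rw [comp_map_compression]
    exact (hA.2 k l φ ψ hφ hψ).conjTranspose_mul_mul_same _⟩
  unit_hermitian := by
    change star (S.unit ⊗ₜ[ℂ] T.unit) = S.unit ⊗ₜ[ℂ] T.unit
    rw [TensorProduct.star_tmul, hS.unit_hermitian, hT.unit_hermitian]
  order_unit := lmin_order_unit hS hT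
  archimedean γ n A hA := by
    refine ⟨?_, fun k m φ ψ hφ hψ => posSemidef_of_forall_add fun r hr => ?_⟩
    · have hunit : ((S.lmin T).unitDiag n).IsHermitian :=
        Matrix.isHermitian_diagonal_of_self_adjoint _ (funext fun _ => by
          change star (S.unit ⊗ₜ[ℂ] T.unit) = S.unit ⊗ₜ[ℂ] T.unit
          rw [TensorProduct.star_tmul, hS.unit_hermitian, hT.unit_hermitian])
      have h := (hA 1 one_pos).1
      rw [Complex.ofReal_one, one_smul] at h
      simpa using h.sub hunit
    · rw [← comp_map_unitDiag (tensorMap_unit hφ hψ)]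
      convert (hA r hr).2 k m φ ψ hφ hψ using 1
      ext a b
      simp

theorem kron_mem_lmin (hS : S.IsLocalOperatorSystem) (hT : T.IsLocalOperatorSystem) {α : Γ} {β : Λ}
    {n m : ℕ} {P : Matrix (Fin n) (Fin n) V} (hP : P ∈ S.cone α n) {Q : Matrix (Fin m) (Fin m) W}
    (hQ : Q ∈ T.cone β m) : kron P Q ∈ (S.lmin T).cone (α, β) (n * m) := by
  refine ⟨?_, fun k l φ ψ hφ hψ => ?_⟩
  · ext a b
    simp [kron, (hS.hermitian α n P hP).apply, (hT.hermitian β m Q hQ).apply]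
  -- Up to a shuffle of indices, `(φ ⊗ ψ)^{(nm)}(P ⊗ Q)` is the Kronecker product of `φ^{(n)}(P)`
  -- and `ψ^{(m)}(Q)`.
  · exact ((hφ.map_cone n P hP).kronecker (hψ.map_cone m Q hQ)).submatrix
      fun a : Fin (n * m) × (Fin k × Fin l) => (((finProdFinEquiv.symm a.1).1, a.2.1), ((finProdFinEquiv.symm a.1).2, a.2.2))

theorem lmin_isTensorStructure (hS : S.IsLocalOperatorSystem) (hT : T.IsLocalOperatorSystem) :
    S.IsTensorStructure T (S.lmin T) where
  unit_eq := rfl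
  isLocalOperatorSystem := lmin_isLocalOperatorSystem hS hT
  exists_index α β := ⟨(α, β), fun _ _ _ hP _ hQ => kron_mem_lmin hS hT hP hQ⟩
  exists_pair γ := ⟨γ.1, γ.2, fun _ _ _ hP _ hQ => kron_mem_lmin hS hT hP hQ⟩
  tensorMap_lucp _ _ _ _ _ _ hφ hψ := isLUCPWrt_tensorMap hφ hψ

end OrderUnit

end MatrixConeFamily

namespace MatrixConeFamily

/-! ### Functoriality, injectivity and symmetry -/

section Functoriality

theorem tensorMap_comp_map {V V' W W' κ μ : Type*} [AddCommGroup V] [Module ℂ V] [AddCommGroup V']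
    [Module ℂ V'] [AddCommGroup W] [Module ℂ W] [AddCommGroup W'] [Module ℂ W']
    (φ : V' →ₗ[ℂ] Matrix κ κ ℂ) (ψ : W' →ₗ[ℂ] Matrix μ μ ℂ) (f : V →ₗ[ℂ] V') (g : W →ₗ[ℂ] W') :
    tensorMap φ ψ ∘ₗ TensorProduct.map f g = tensorMap (φ ∘ₗ f) (ψ ∘ₗ g) :=
  TensorProduct.ext' fun _ _ => rfl

variable {V V' W W' Γ Γ' Λ Λ' : Type*}
  [AddCommGroup V] [Module ℂ V] [StarAddMonoid V] [StarModule ℂ V]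
  [AddCommGroup V'] [Module ℂ V'] [StarAddMonoid V'] [StarModule ℂ V']
  [AddCommGroup W] [Module ℂ W] [StarAddMonoid W] [StarModule ℂ W]
  [AddCommGroup W'] [Module ℂ W'] [StarAddMonoid W'] [StarModule ℂ W']
  {S : MatrixConeFamily V Γ} {S' : MatrixConeFamily V' Γ'}
  {T : MatrixConeFamily W Λ} {T' : MatrixConeFamily W' Λ'}

theorem map_star_tensor {f : V →ₗ[ℂ] V'} {g : W →ₗ[ℂ] W'} (hf : ∀ v, f (star v) = star (f v))
    (hg : ∀ w, g (star w) = star (g w)) (x : V ⊗[ℂ] W) :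
    TensorProduct.map f g (star x) = star (TensorProduct.map f g x) := by
  induction x with
  | zero => simp
  | tmul v w => simp [hf, hg]
  | add x y hx hy => simp [hx, hy]

theorem isHermitian_map {V V' : Type*} [AddCommGroup V] [StarAddMonoid V] [AddCommGroup V']
    [StarAddMonoid V'] {f : V → V'} (hf : ∀ v, f (star v) = star (f v)) {n : ℕ}
    {A : Matrix (Fin n) (Fin n) V} (hA : A.IsHermitian) : (A.map f).IsHermitian :=
  hA.map f fun v => hf v

theorem lmin_map_mem {f : V →ₗ[ℂ] V'} {g : W →ₗ[ℂ] W'} (hf : ∀ v, f (star v) = star (f v))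
    (hg : ∀ w, g (star w) = star (g w)) (hf1 : f S.unit = S'.unit) (hg1 : g T.unit = T'.unit)
    {α : Γ} {α' : Γ'} {β : Λ} {β' : Λ'} (hα : ∀ n, ∀ A ∈ S.cone α n, A.map f ∈ S'.cone α' n)
    (hβ : ∀ n, ∀ A ∈ T.cone β n, A.map g ∈ T'.cone β' n) {n : ℕ}
    {A : Matrix (Fin n) (Fin n) (V ⊗[ℂ] W)} (hA : A ∈ (S.lmin T).cone (α, β) n) :
    A.map (TensorProduct.map f g) ∈ (S'.lmin T').cone (α', β') n := by
  refine ⟨isHermitian_map (map_star_tensor hf hg) hA.1, fun k m φ ψ hφ hψ => ?_⟩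
  have h := hA.2 k m _ _ (hφ.comp hf1 hα) (hψ.comp hg1 hβ)
  rwa [← tensorMap_comp_map] at h

theorem lmin_isLUCP_map (hS : S.IsLocalOperatorSystem) (hS' : S'.IsLocalOperatorSystem)
    (hT : T.IsLocalOperatorSystem) (hT' : T'.IsLocalOperatorSystem) {f : V →ₗ[ℂ] V'}
    {g : W →ₗ[ℂ] W'} (hf : S.IsLUCP S' f) (hg : T.IsLUCP T' g) :
    (S.lmin T).IsLUCP (S'.lmin T') (TensorProduct.map f g) where
  map_unit := by
    change f S.unit ⊗ₜ[ℂ] g T.unit = S'.unit ⊗ₜ[ℂ] T'.unit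
    rw [hf.map_unit, hg.map_unit]
  map_cone := by
    rintro ⟨α', β'⟩
    obtain ⟨α, hα⟩ := hf.map_cone α'
    obtain ⟨β, hβ⟩ := hg.map_cone β'
    exact ⟨(α, β), fun n A hA => lmin_map_mem (hf.map_star hS hS') (hg.map_star hT hT')
      hf.map_unit hg.map_unit hα hβ hA⟩

theorem lmin_isCompleteOrderEmbedding_map (hS : S.IsLocalOperatorSystem)
    (hS' : S'.IsLocalOperatorSystem) (hT : T.IsLocalOperatorSystem)
    (hT' : T'.IsLocalOperatorSystem) {σ : Γ ≃ Γ'} {ρ : Λ ≃ Λ'} {f : V →ₗ[ℂ] V'}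
    {g : W →ₗ[ℂ] W'} (hf : S.IsCompleteOrderEmbedding S' σ f)
    (hg : T.IsCompleteOrderEmbedding T' ρ g) :
    (S.lmin T).IsCompleteOrderEmbedding (S'.lmin T') (Equiv.prodCongr σ ρ)
      (TensorProduct.map f g) := by
  have hinj : Function.Injective (TensorProduct.map f g) :=
    TensorProduct.map_injective_of_flat_flat f g hf.injective hg.injective
  have hstar := map_star_tensor (hf.map_star hS hS') (hg.map_star hT hT')
  refine ⟨hinj, ?_, ?_⟩
  · change f S.unit ⊗ₜ[ℂ] g T.unit = S'.unit ⊗ₜ[ℂ] T'.unit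
    rw [hf.map_unit, hg.map_unit]
  · rintro ⟨α, β⟩ n
    apply Set.Subset.antisymm
    · rintro _ ⟨A, hA, rfl⟩
      exact ⟨lmin_map_mem (hf.map_star hS hS') (hg.map_star hT hT') hf.map_unit hg.map_unit
        (fun n A hA => hf.map_mem_iff.2 hA) (fun n A hA => hg.map_mem_iff.2 hA) hA,
        fun i k => ⟨A i k, rfl⟩⟩
    · rintro B ⟨hB, hrange⟩
      choose a ha using hrange
      obtain rfl : (Matrix.of a).map (TensorProduct.map f g) = B := by
        ext i k
        exact ha i k
      refine ⟨Matrix.of a, ⟨?_, fun k m φ ψ hφ hψ => ?_⟩, rfl⟩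
      · ext i k
        apply hinj
        rw [Matrix.conjTranspose_apply, hstar]
        exact hB.1.apply i k
      -- Membership in the large lmin cone only tests maps on the large systems; Arveson extension
      -- shows that these restrict to all test maps on the small ones.
      · obtain ⟨φ', hφ', rfl⟩ := hφ.exists_extension hS hS' hf
        obtain ⟨ψ', hψ', rfl⟩ := hψ.exists_extension hT hT' hg
        rw [← tensorMap_comp_map]
        exact hB.2 k m φ' ψ' hφ' hψ'

theorem comm_star (x : V ⊗[ℂ] W) :
    TensorProduct.comm ℂ V W (star x) = star (TensorProduct.comm ℂ V W x) := by
  induction x with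
  | zero => simp
  | tmul v w => simp
  | add x y hx hy => simp [hx, hy]

theorem tensorMap_comm {V W κ μ : Type*} [AddCommGroup V] [Module ℂ V] [AddCommGroup W] [Module ℂ W]
    (φ : V →ₗ[ℂ] Matrix κ κ ℂ) (ψ : W →ₗ[ℂ] Matrix μ μ ℂ)
    (x : V ⊗[ℂ] W) (a b : μ × κ) :
    tensorMap ψ φ (TensorProduct.comm ℂ V W x) a b = tensorMap φ ψ x a.swap b.swap := by
  induction x with
  | zero => simp
  | tmul v w => simp [mul_comm]
  | add x y hx hy => simp [hx, hy]

theorem lmin_comm_mem {α : Γ} {β : Λ} {n : ℕ} {A : Matrix (Fin n) (Fin n) (V ⊗[ℂ] W)}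
    (hA : A ∈ (S.lmin T).cone (α, β) n) :
    A.map (TensorProduct.comm ℂ V W) ∈ (T.lmin S).cone (β, α) n := by
  refine ⟨isHermitian_map comm_star hA.1, fun k m ψ φ hψ hφ => ?_⟩
  convert (hA.2 m k φ ψ hφ hψ).submatrix (Prod.map id Prod.swap) using 1
  ext a b
  exact tensorMap_comm φ ψ _ _ _

theorem isCompleteOrderIso_of_mem {V W Γ Λ : Type*} [AddCommGroup V] [Module ℂ V] [AddCommGroup W]
    [Module ℂ W] {S : MatrixConeFamily V Γ} {T : MatrixConeFamily W Λ} {σ : Γ ≃ Λ} {f : V ≃ₗ[ℂ] W}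
    (h1 : f S.unit = T.unit) (hf : ∀ α n, ∀ A ∈ S.cone α n, A.map f ∈ T.cone (σ α) n)
    (hf' : ∀ α n, ∀ B ∈ T.cone (σ α) n, B.map f.symm ∈ S.cone α n) :
    S.IsCompleteOrderIso T σ f where
  map_unit := h1
  map_cone α n := by
    apply Set.Subset.antisymm
    · rintro _ ⟨A, hA, rfl⟩
      exact hf α n A hA
    · intro B hB
      refine ⟨_, hf' α n B hB, ?_⟩
      ext i j
      simp

theorem lmin_isCompleteOrderIso_comm :
    (S.lmin T).IsCompleteOrderIso (T.lmin S) (Equiv.prodComm Γ Λ) (TensorProduct.comm ℂ V W) :=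
  isCompleteOrderIso_of_mem rfl (fun _ _ _ hA => lmin_comm_mem hA)
    fun _ _ _ hB => lmin_comm_mem hB

end Functoriality

/-! ### Associativity -/

section Associativity

variable {U V W Γ Λ Ω : Type*}
  [AddCommGroup U] [Module ℂ U] [StarAddMonoid U] [StarModule ℂ U]
  [AddCommGroup V] [Module ℂ V] [StarAddMonoid V] [StarModule ℂ V]
  [AddCommGroup W] [Module ℂ W] [StarAddMonoid W] [StarModule ℂ W]
  {R : MatrixConeFamily U Γ} {S : MatrixConeFamily V Λ} {T : MatrixConeFamily W Ω}

theorem assoc_star (x : (U ⊗[ℂ] V) ⊗[ℂ] W) :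
    TensorProduct.assoc ℂ U V W (star x) = star (TensorProduct.assoc ℂ U V W x) := by
  induction x with
  | zero => simp
  | add x y hx hy => simp [hx, hy]
  | tmul y w =>
    induction y with
    | zero => simp
    | add x y hx hy => simp_all [TensorProduct.add_tmul]
    | tmul u v => simp

theorem tensorMap_assoc {U V W : Type*} [AddCommGroup U] [Module ℂ U] [AddCommGroup V]
    [Module ℂ V] [AddCommGroup W] [Module ℂ W] {κ μ ν : Type*} (φ : U →ₗ[ℂ] Matrix κ κ ℂ) (ψ : V →ₗ[ℂ] Matrix μ μ ℂ)
    (χ : W →ₗ[ℂ] Matrix ν ν ℂ) (x : (U ⊗[ℂ] V) ⊗[ℂ] W) (a b : κ × μ × ν) :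
    tensorMap φ (tensorMap ψ χ) (TensorProduct.assoc ℂ U V W x) a b =
      tensorMap (tensorMap φ ψ) χ x ((a.1, a.2.1), a.2.2) ((b.1, b.2.1), b.2.2) := by
  induction x with
  | zero => simp
  | add x y hx hy => simp [hx, hy]
  | tmul y w =>
    induction y with
    | zero => simp
    | add x y hx hy => simp_all [TensorProduct.add_tmul]
    | tmul u v => simp [mul_assoc]

theorem sliceLeft_star {f g : V →ₗ[ℂ] ℂ} (h : ∀ v, f (star v) = star (g v)) (x : V ⊗[ℂ] W) :
    sliceLeft f (star x) = star (sliceLeft g x) := by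
  induction x with
  | zero => simp
  | add x y hx hy => simp [hx, hy]
  | tmul v w => simp [h]

theorem lmin_assoc_mem (hR : R.IsLocalOperatorSystem) {α : Γ} {β : Λ} {γ : Ω} {n : ℕ}
    {A : Matrix (Fin n) (Fin n) ((U ⊗[ℂ] V) ⊗[ℂ] W)}
    (hA : A ∈ ((R.lmin S).lmin T).cone ((α, β), γ) n) :
    A.map (TensorProduct.assoc ℂ U V W) ∈ (R.lmin (S.lmin T)).cone (α, (β, γ)) n := by
  refine ⟨isHermitian_map assoc_star hA.1, fun k m φ θ hφ hθ => ?_⟩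
  let e : Fin (n * k) ≃ Fin n × Fin k := finProdFinEquiv.symm
  -- `B` is the image of `A` under `φ ⊗ id`, flattened to level `nk`. Applying `ψ ⊗ χ` to it amounts
  -- to applying `(φ ⊗ ψ) ⊗ χ` to `A`, and applying `θ` gives `φ ⊗ θ` on the reassociated `A`.
  let B : Matrix (Fin (n * k)) (Fin (n * k)) (V ⊗[ℂ] W) := Matrix.of fun a b =>
    sliceLeft (entryMap φ (e a).2 (e b).2) (TensorProduct.assoc ℂ U V W (A (e a).1 (e b).1))
  have hB : B ∈ (S.lmin T).cone (β, γ) (n * k) := by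
    refine ⟨?_, fun l p ψ χ hψ hχ => ?_⟩
    · ext a b
      simp only [B, Matrix.conjTranspose_apply, Matrix.of_apply]
      rw [← sliceLeft_star (f := entryMap φ (e a).2 (e b).2), ← assoc_star, hA.1.apply]
      intro v
      rw [entryMap_apply, hφ.map_star hR]
      rfl
    · have h := lmin_posSemidef hA (isLUCPWrt_tensorMap hφ hψ) hχ
      convert h.submatrix fun a : Fin (n * k) × (Fin l × Fin p) =>
        ((e a.1).1, (((e a.1).2, a.2.1), a.2.2)) using 1
      ext a b
      refine Eq.trans ?_ (tensorMap_assoc φ ψ χ (A (e a.1).1 (e b.1).1) ((e a.1).2, a.2)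
        ((e b.1).2, b.2))
      rw [tensorMap_apply_eq_right]
      rfl
  convert (hθ.map_cone _ B hB).submatrix fun a : Fin n × (Fin k × Fin m) =>
    (e.symm (a.1, a.2.1), a.2.2) using 1
  ext a b
  simp only [Matrix.comp_apply, Matrix.map_apply, tensorMap_apply_eq_right, Matrix.submatrix_apply,
    B, Matrix.of_apply, Equiv.apply_symm_apply]

/-- The inverse associator is a composite of flips with the forward associator for `W, V, U`: `U(VW)
→ (VW)U → (WV)U → W(VU) → (VU)W → (UV)W`. -/
theorem lmin_assoc_symm_mem (hT : T.IsLocalOperatorSystem) {α : Γ} {β : Λ} {γ : Ω} {n : ℕ}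
    {A : Matrix (Fin n) (Fin n) (U ⊗[ℂ] (V ⊗[ℂ] W))}
    (hA : A ∈ (R.lmin (S.lmin T)).cone (α, (β, γ)) n) :
    A.map (TensorProduct.assoc ℂ U V W).symm ∈ ((R.lmin S).lmin T).cone ((α, β), γ) n := by
  have h1 := lmin_map_mem (f := (TensorProduct.comm ℂ V W).toLinearMap) (g := LinearMap.id)
    (S' := T.lmin S) (T' := R) comm_star (fun _ => rfl) rfl rfl
    (fun n A hA => lmin_comm_mem hA) (fun n A hA => by simpa using hA) (lmin_comm_mem hA)
  have h2 := lmin_map_mem (f := (TensorProduct.comm ℂ V U).toLinearMap) (g := LinearMap.id)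
    (S' := R.lmin S) (T' := T) comm_star (fun _ => rfl) rfl rfl
    (fun n A hA => lmin_comm_mem hA) (fun n A hA => by simpa using hA)
    (lmin_comm_mem (lmin_assoc_mem hT h1))
  convert h2 using 1
  ext i j
  simp only [Matrix.map_apply]
  induction A i j with
  | zero => simp
  | add x y hx hy => simp [hx, hy]
  | tmul u z =>
    induction z with
    | zero => simp
    | add x y hx hy => simp_all [TensorProduct.tmul_add]
    | tmul v w => simp

theorem lmin_isCompleteOrderIso_assoc (hR : R.IsLocalOperatorSystem)
    (hT : T.IsLocalOperatorSystem) :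
    ((R.lmin S).lmin T).IsCompleteOrderIso (R.lmin (S.lmin T)) (Equiv.prodAssoc Γ Λ Ω)
      (TensorProduct.assoc ℂ U V W) :=
  isCompleteOrderIso_of_mem rfl (fun _ _ _ hA => lmin_assoc_mem hR hA)
    fun _ _ _ hB => lmin_assoc_symm_mem hT hB

end Associativity

end MatrixConeFamily

/-- The minimal local operator system tensor product. -/
def LocalTensorProduct.lmin : LocalTensorProduct.{u, v} where
  cones V W := V.cones.lmin W.cones
  isTensorStructure V W := MatrixConeFamily.lmin_isTensorStructure V.isLocalOperatorSystem
    W.isLocalOperatorSystem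

end

theorem mainTheorem9 :
    ∃ τ : LocalTensorProduct.{u, v},
      (∀ V W : LO.{u, v}, τ.cones V W = V.cones.lmin W.cones) ∧
      τ.IsInjective ∧ τ.IsAssociative ∧ τ.IsSymmetric ∧ τ.IsFunctorial :=
  ⟨LocalTensorProduct.lmin, fun _ _ => rfl,
    fun V₁ V₂ W₁ W₂ _ _ _ _ hi hj => MatrixConeFamily.lmin_isCompleteOrderEmbedding_map
      V₁.isLocalOperatorSystem V₂.isLocalOperatorSystem W₁.isLocalOperatorSystem
      W₂.isLocalOperatorSystem hi hj,
    fun U _ W => MatrixConeFamily.lmin_isCompleteOrderIso_assoc U.isLocalOperatorSystem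
      W.isLocalOperatorSystem,
    fun _ _ => MatrixConeFamily.lmin_isCompleteOrderIso_comm,
    fun V₁ V₂ W₁ W₂ _ _ hφ hψ => MatrixConeFamily.lmin_isLUCP_map V₁.isLocalOperatorSystem
      V₂.isLocalOperatorSystem W₁.isLocalOperatorSystem W₂.isLocalOperatorSystem hφ hψ⟩
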